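/- An embedded planar $st$-graph is a finite acyclic directed graph $G=(V,E)$ without parallel edges that has a single source $s$ and a single sink $t$, together with a fixed planar (combinatorial) embedding in which $s$ and $t$ both lie on the outer face; the edge $(s,t)$ need not be present. For $u\in V$ let $S(u)=(v_1,\dots,v_m)$ be the list of successors of $u$ in the clockwise order in which the outgoing edges $(u,v_1),\dots,(u,v_m)$ follow each other consecutively around $u$; for $u=s$ the list is chosen such that $v_m,s,v_1$ appear clockwise on the outer face. An $st$-ordering is a bijection $\pi:V\to\{1,\dots,|V|\}$, with $\pi(s)=1$ and $\pi(t)=|V|$, such that $\pi(u)<\pi(v)$ for every edge $(u,v)\in E$. It is bitonic if for every vertex $u\neq t$ with $S(u)=(v_1,\dots,v_m)$ there is $1\le h\le m$ with $\pi(v_1)<\cdots<\pi(v_h)>\cdots>\pi(v_m)$. Splitting an edge $(u,v)$ means replacing it by two edges $(u,v')$ and $(v',v)$, where $v'$ is a new dummy vertex, which take the place of $(u,v)$ in the embedding. Lemma. Let $G=(V,E)$ be an embedded planar $st$-graph with $|V|\ge 3$. Then there is a set $F\subseteq E$ of at most $|V|-3$ edges such that splitting every edge of $F$ (once) yields an embedded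 planar $st$-graph, with the same source and sink, that admits a bitonic $st$-ordering. -/

import Mathlib

/-- A directed graph with vertex type `V` and edge type `E`, together with a combinatorial embedding
in an oriented surface and a distinguished outer face.

Every edge `e` has two darts (half-edges): `(e, true)`, attached to the source `src e`
(an outgoing dart), and `(e, false)`, attached to the target `tgt e` (an incoming dart).
The permutation `rot` maps a dart to the next dart clockwise around the vertex it is attached to,
so its cycles are exactly the sets of darts attached to a common vertex.
The outer face is the face that contains the dart `outer`, see `EmbeddedDigraph.facePerm`. -/
structure EmbeddedDigraph (V E : Type*) where
  src : E → V
  tgt : E → V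
  rot : Equiv.Perm (E × Bool)
  sameCycle_rot_iff : ∀ d d' : E × Bool, rot.SameCycle d d' ↔
    (bif d.2 then src d.1 else tgt d.1) = (bif d'.2 then src d'.1 else tgt d'.1)
  outer : E × Bool

/-- The other dart of the same edge. -/
def dartFlip (E : Type*) : Equiv.Perm (E × Bool) :=
  Equiv.prodCongr (Equiv.refl E) Equiv.boolNot

namespace EmbeddedDigraph

variable {V E : Type*} (G : EmbeddedDigraph V E)

/-- The vertex that a dart is attached to. -/
def vert (d : E × Bool) : V := bif d.2 then G.src d.1 else G.tgt d.1

/-- `G.Adj u v`: there is an edge from `u` to `v`. -/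
def Adj (u v : V) : Prop := ∃ e, G.src e = u ∧ G.tgt e = v

/-- The face permutation: walk along a dart `d` from its vertex to the other end of the edge, and
leave by the next dart clockwise there. The faces of the embedding are the cycles of this
permutation. The face of `d` lies to the left of `d`, and its corner at the start of `d`
is the one between `rot⁻¹ d` and its clockwise successor `d`. The outer face is thus traversed
clockwise, every other face counterclockwise. -/
def facePerm : Equiv.Perm (E × Bool) := (dartFlip E).trans G.rot

/-- The faces of the embedding. -/
def Face : Type _ := Quotient (Equiv.Perm.SameCycle.setoid G.facePerm)

/-- The dart `d` belongs to the outer face. -/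
def OnOuter (d : E × Bool) : Prop := G.facePerm.SameCycle G.outer d

/-- The embedding is plane: the graph is connected and Euler's formula
`|V| - |E| + |F| = 2` holds, so that the surface is the sphere. -/
def IsPlane : Prop :=
  (∀ u v, Relation.EqvGen G.Adj u v) ∧ Nat.card V + Nat.card G.Face = Nat.card E + 2

/-- `v` has no incoming edge. -/
def IsSource (v : V) : Prop := ∀ e, G.tgt e ≠ v

/-- `v` has no outgoing edge. -/
def IsSink (v : V) : Prop := ∀ e, G.src e ≠ v

/-- `G` is an embedded planar `st`-graph: a plane acyclic directed graph without parallel edges,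
with `s` as its only source and `t` as its only sink, both on the outer face. -/
structure IsPlanarST (s t : V) : Prop where
  plane : G.IsPlane
  acyclic : ∀ v, ¬ Relation.TransGen G.Adj v v
  no_parallel : ∀ e f, G.src e = G.src f → G.tgt e = G.tgt f → e = f
  source_iff : ∀ v, G.IsSource v ↔ v = s
  sink_iff : ∀ v, G.IsSink v ↔ v = t
  source_outer : ∃ d, G.vert d = s ∧ G.OnOuter d
  sink_outer : ∃ d, G.vert d = t ∧ G.OnOuter d

/-- `L` lists the outgoing edges `(u, v₁), …, (u, vₘ)` of `u` in the order in which they follow each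
other clockwise around `u`. At a source, where all darts are outgoing, the list starts
with the edge that follows the corner of `u` in the outer face, so that `vₘ, u, v₁` are
consecutive in clockwise direction on the outer face. -/
def IsOutList (u : V) (L : List E) : Prop :=
  L.Nodup ∧ (∀ e, e ∈ L ↔ G.src e = u) ∧
  L.IsChain (fun e f => G.rot (e, true) = (f, true)) ∧
  (G.IsSource u → ∀ e ∈ L.head?, G.OnOuter (e, true))

/-- `π`, the rank function of an ordering of the vertices (ranks counted from `0`), is an
`st`-ordering: `s` comes first, `t` comes last, and every edge goes from a lower to a
higher rank. -/
def IsSTOrdering [Fintype V] (s t : V) (π : V ≃ Fin (Fintype.card V)) : Prop :=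
  (∀ v, π s ≤ π v) ∧ (∀ v, π v ≤ π t) ∧ ∀ e, π (G.src e) < π (G.tgt e)

end EmbeddedDigraph

/-- A list is (strictly) bitonic increasing: it increases strictly up to the entry with index `h` and
decreases strictly from that entry on. -/
def IsBitonic {α : Type*} [LinearOrder α] (L : List α) : Prop :=
  ∃ h : ℕ, (L.take (h + 1)).Pairwise (· < ·) ∧ (L.drop h).Pairwise (· > ·)

namespace EmbeddedDigraph

variable {V E : Type*} (G : EmbeddedDigraph V E)

/-- `π` is a bitonic `st`-ordering: an `st`-ordering for which the ranks of the successors of every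
vertex, in their clockwise order, form a bitonic sequence. -/
def IsBitonicSTOrdering [Fintype V] (s t : V) (π : V ≃ Fin (Fintype.card V)) : Prop :=
  G.IsSTOrdering s t π ∧
  ∀ u, ∃ L, G.IsOutList u L ∧ IsBitonic (L.map fun e => π (G.tgt e))

section Split

variable [DecidableEq E] (F : Finset E)

/-- The darts after splitting the edges in `F`. Every `e ∈ F` is replaced by two edges, `Sum.inl e`
from the source of `e` to the dummy vertex of `e` and `Sum.inr e` from there to the target of
`e`. The edges outside `F` are kept as `Sum.inl e`. The darts at the old vertices
correspond to the darts of `G`; the dummy vertex of `f ∈ F` has the two darts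
`(Sum.inl f, false)` and `(Sum.inr f, true)`. -/
def splitDart : (E × Bool) ⊕ (F × Bool) ≃ (E ⊕ F) × Bool where
  toFun
    | .inl (e, true) => (.inl e, true)
    | .inl (e, false) => if h : e ∈ F then (.inr ⟨e, h⟩, false) else (.inl e, false)
    | .inr (f, true) => (.inl f.1, false)
    | .inr (f, false) => (.inr f, true)
  invFun
    | (.inl e, true) => .inl (e, true)
    | (.inl e, false) => if h : e ∈ F then .inr (⟨e, h⟩, true) else .inl (e, false)
    | (.inr f, true) => .inr (f, false)
    | (.inr f, false) => .inl (f.1, false)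
  left_inv := by
    rintro (⟨e, _ | _⟩ | ⟨f, _ | _⟩)
    · by_cases h : e ∈ F <;> simp [h]
    · rfl
    · rfl
    · simp
  right_inv := by
    rintro ⟨e | f, _ | _⟩
    · by_cases h : e ∈ F <;> simp [h]
    · rfl
    · simp
    · rfl

/-- The source of an edge after splitting. -/
def splitSrc : E ⊕ F → V ⊕ F
  | .inl e => .inl (G.src e)
  | .inr f => .inr f

/-- The target of an edge after splitting. -/
def splitTgt : E ⊕ F → V ⊕ F
  | .inl e => if h : e ∈ F then .inr ⟨e, h⟩ else .inl (G.tgt e)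
  | .inr f => .inl (G.tgt f.1)

/-- The rotation after splitting: unchanged around the old vertices, and the two darts at every dummy
vertex are exchanged. -/
def splitRot : Equiv.Perm ((E ⊕ F) × Bool) :=
  (splitDart F).permCongr (Equiv.Perm.sumCongr G.rot (dartFlip F))

theorem vert_splitDart_inl (d : E × Bool) :
    (bif (splitDart F (.inl d)).2 then G.splitSrc F (splitDart F (.inl d)).1
      else G.splitTgt F (splitDart F (.inl d)).1) = .inl (G.vert d) := by
  rcases d with ⟨e, _ | _⟩
  · by_cases h : e ∈ F <;> simp [splitDart, splitTgt, vert, h]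
  · simp [splitDart, splitSrc, vert]

theorem vert_splitDart_inr (d : F × Bool) :
    (bif (splitDart F (.inr d)).2 then G.splitSrc F (splitDart F (.inr d)).1
      else G.splitTgt F (splitDart F (.inr d)).1) = .inr d.1 := by
  rcases d with ⟨f, _ | _⟩ <;> simp [splitDart, splitSrc, splitTgt]

theorem splitRot_sameCycle_iff (x y : (E × Bool) ⊕ (F × Bool)) :
    (G.splitRot F).SameCycle (splitDart F x) (splitDart F y) ↔
      (Equiv.Perm.sumCongr G.rot (dartFlip F)).SameCycle x y := by
  have key : ∀ (k : ℤ), ((G.splitRot F) ^ k) (splitDart F x) =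
      splitDart F ((Equiv.Perm.sumCongr G.rot (dartFlip F) ^ k) x) := by
    intro k
    have h := map_zpow (splitDart F).permCongrHom (Equiv.Perm.sumCongr G.rot (dartFlip F)) k
    have h' : (splitDart F).permCongr (Equiv.Perm.sumCongr G.rot (dartFlip F) ^ k) =
      (G.splitRot F) ^ k := h
    rw [← h', Equiv.permCongr_apply, Equiv.symm_apply_apply]
  simp only [Equiv.Perm.SameCycle, key, EmbeddingLike.apply_eq_iff_eq]

theorem sumCongr_zpow {α β : Type*} (p : Equiv.Perm α) (q : Equiv.Perm β) (k : ℤ) :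
    Equiv.Perm.sumCongr p q ^ k = Equiv.Perm.sumCongr (p ^ k) (q ^ k) :=
  (map_zpow (Equiv.Perm.sumCongrHom α β) (p, q) k).symm

/-- The embedded graph obtained by splitting the edges in `F`: every edge `(u, v)` in `F` is replaced
by a path of length two from `u` to `v` through a new dummy vertex (named `Sum.inr` of that
edge), whose two edges take the place of `(u, v)` in the embedding. The faces remain the same
apart from the subdivided edges, and so does the outer face. -/
def split : EmbeddedDigraph (V ⊕ F) (E ⊕ F) where
  src := G.splitSrc F
  tgt := G.splitTgt F
  rot := G.splitRot F
  sameCycle_rot_iff := by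
    intro d d'
    obtain ⟨x, rfl⟩ := (splitDart F).surjective d
    obtain ⟨y, rfl⟩ := (splitDart F).surjective d'
    rw [splitRot_sameCycle_iff]
    rcases x with x | x <;> rcases y with y | y <;>
      simp only [vert_splitDart_inl, vert_splitDart_inr, Equiv.Perm.SameCycle, sumCongr_zpow,
        Equiv.Perm.sumCongr_apply, Sum.map_inl, Sum.map_inr, Sum.inl.injEq, Sum.inr.injEq,
        reduceCtorEq, exists_const]
    · exact G.sameCycle_rot_iff x y
    · rcases x with ⟨f, b⟩
      rcases y with ⟨f', b'⟩
      constructor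
      · rintro ⟨k, hk⟩
        have hfix : ∀ (k : ℤ) (z : F × Bool), ((dartFlip F ^ k) z).1 = z.1 := by
          intro k
          induction k with
          | zero => simp
          | succ n ih => intro z; rw [zpow_add_one, Equiv.Perm.mul_apply, ih]; rfl
          | pred n ih => intro z; rw [zpow_sub_one, Equiv.Perm.mul_apply, ih]; rfl
        rw [← hfix k (f, b), hk]
      · intro h
        have h' : f = f' := h
        subst h'
        by_cases hb : b = b'
        · exact ⟨0, by simp [hb]⟩
        · exact ⟨1, by cases b <;> cases b' <;> simp_all [dartFlip]⟩
  outer := splitDart F (.inl G.outer)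

end Split

end EmbeddedDigraph

/-! Every inner face of a planar st-graph is bounded by a left and a right directed path, from its
only source corner to its only sink corner. If no left path is a single edge, adding an arc from
each successor of a vertex to the next one clockwise, across the inner face between them, keeps the
graph acyclic. A topological order then makes all successor lists increasing, hence bitonic. If no
right path is a single edge, the mirror image gives decreasing lists. Splitting all single-edge
boundaries of one side removes them and creates no new ones, so it remains to count. Both paths of
an inner face cannot be single edges, as these would be parallel. Hence the two kinds together
number at most |Faces| - 1 ≤ 2|V| - 5 by Euler's formula, and one kind has at most |V| - 3 members.

Planarity enters only through Euler's formula. Counting corners against it gives uniqueness of the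
source and sink corners (`IsPlanarST.corner_injective`). Counting dimensions shows that circulations
are exactly the differences of face potentials, and cocycles those of vertex potentials
(`IsPlane.exists_faceDiff_eq`, `IsPlane.exists_vertDiff_eq`). Acyclicity is then proved by turning a
closed walk into a nonzero nonnegative flow and showing that its potential forces it to vanish. This
is done for the dual graph (`IsPlanarST.dual_acyclic`), whose left-to-right order supports the
induction in `IsPlanarST.potential_eq_zero`, and then for the graph with the added arcs
(`IsPlanarST.adjOrNext_acyclic`). -/

namespace Equiv.Perm

/-! ### Cycles of permutations -/

theorem apply_inv_apply {α : Type*} (p : Perm α) (x : α) : p (p⁻¹ x) = x := p.apply_symm_apply x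

theorem inv_apply_apply {α : Type*} (p : Perm α) (x : α) : p⁻¹ (p x) = x := p.symm_apply_apply x

theorem SameCycle.of_forall_step {α β : Type*} {p : Perm α} {q : Perm β} (r : α → β)
    (h : ∀ x, q.SameCycle (r x) (r (p x))) {x y : α} (hxy : p.SameCycle x y) :
    q.SameCycle (r x) (r y) := by
  obtain ⟨k, rfl⟩ := hxy
  induction k with
  | zero => exact SameCycle.refl _ _
  | succ n ih => exact ih.trans (by rw [add_comm, zpow_add, zpow_one, mul_apply]; exact h _)
  | pred n ih =>
    refine ih.trans (SameCycle.symm ?_)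
    have := h ((p ^ (-(n : ℤ) - 1)) x)
    rwa [← mul_apply, mul_self_zpow, sub_add_cancel] at this

theorem SameCycle.eq_of_forall_step {α γ : Type*} {p : Perm α} (g : α → γ)
    (h : ∀ x, g (p x) = g x) {x y : α} (hxy : p.SameCycle x y) : g x = g y := by
  obtain ⟨k, hk⟩ := hxy.of_forall_step (q := (1 : Perm γ)) g
    (fun x => by rw [h])
  simpa using hk

/-- Without a rise the value would stay `false` along all forward iterates from `x`, and on a finite
type these exhaust the cycle. -/
theorem SameCycle.exists_rise {α : Type*} [Finite α] {p : Perm α} (b : α → Bool) {x y : α}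
    (h : p.SameCycle x y) (hx : b x = false) (hy : b y = true) :
    ∃ z, p.SameCycle x z ∧ b (p⁻¹ z) = false ∧ b z = true := by
  by_contra! hc
  obtain ⟨n, rfl⟩ := h.exists_nat_pow_eq
  have key : ∀ n : ℕ, b ((p ^ n) x) = false := by
    intro n
    induction n with
    | zero => simpa using hx
    | succ n ih =>
      have := hc ((p ^ (n + 1)) x) ⟨(n + 1 : ℕ), by rw [zpow_natCast]⟩
      rw [pow_succ', mul_apply, inv_apply_apply] at this
      rw [pow_succ', mul_apply]
      simpa using this ih
  simp [key n] at hy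

end Equiv.Perm

/-! ### Darts, faces and corners -/

@[simp] theorem dartFlip_apply {E : Type*} (d : E × Bool) : dartFlip E d = (d.1, !d.2) := rfl

theorem dartFlip_dartFlip {E : Type*} (d : E × Bool) : dartFlip E (dartFlip E d) = d := by simp

namespace EmbeddedDigraph

open Equiv.Perm

variable {V E : Type*} (G : EmbeddedDigraph V E)

/-- The face to the left of a dart. -/
def face (d : E × Bool) : G.Face := Quotient.mk _ d

theorem face_eq_iff {d d' : E × Bool} : G.face d = G.face d' ↔ G.facePerm.SameCycle d d' :=
  Quotient.eq (r := Equiv.Perm.SameCycle.setoid G.facePerm)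

theorem face_surjective : Function.Surjective G.face := Quotient.mk_surjective

theorem onOuter_iff {d : E × Bool} : G.OnOuter d ↔ G.face d = G.face G.outer := by
  rw [eq_comm, face_eq_iff]; rfl

instance [Finite E] : Finite G.Face := Finite.of_surjective _ G.face_surjective

theorem facePerm_apply (d : E × Bool) : G.facePerm d = G.rot (d.1, !d.2) := rfl

theorem face_facePerm (d : E × Bool) : G.face (G.facePerm d) = G.face d := by
  rw [face_eq_iff]; exact sameCycle_apply_left.2 (SameCycle.refl _ _)

theorem face_rot (d : E × Bool) : G.face (G.rot d) = G.face (d.1, !d.2) := by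
  rw [← face_facePerm G (d.1, !d.2), facePerm_apply, Bool.not_not]

theorem vert_eq_iff {d d' : E × Bool} : G.vert d = G.vert d' ↔ G.rot.SameCycle d d' :=
  (G.sameCycle_rot_iff d d').symm

theorem vert_rot (d : E × Bool) : G.vert (G.rot d) = G.vert d := by
  rw [vert_eq_iff]; exact sameCycle_apply_left.2 (SameCycle.refl _ _)

theorem vert_rot_inv (d : E × Bool) : G.vert (G.rot⁻¹ d) = G.vert d := by
  rw [← vert_rot, apply_inv_apply]

@[simp] theorem vert_true (e : E) : G.vert (e, true) = G.src e := rfl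
@[simp] theorem vert_false (e : E) : G.vert (e, false) = G.tgt e := rfl

theorem vert_facePerm (d : E × Bool) : G.vert (G.facePerm d) = G.vert (d.1, !d.2) := by
  rw [facePerm_apply, vert_rot]

/-- The corner that ends, in clockwise order, with the dart `d` lies between two darts with the given
directions. -/
def Corner (a b : Bool) (d : E × Bool) : Prop := (G.rot⁻¹ d).2 = a ∧ d.2 = b

theorem facePerm_inv_snd (d : E × Bool) : (G.facePerm⁻¹ d).2 = !(G.rot⁻¹ d).2 := by
  have : G.facePerm⁻¹ d = dartFlip E (G.rot⁻¹ d) := by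
    rw [inv_eq_iff_eq, facePerm_apply]; simp
  rw [this]; rfl

variable {G}

theorem adj_facePerm_of_true {d : E × Bool} (h : d.2 = true) :
    G.Adj (G.vert d) (G.vert (G.facePerm d)) := by
  rw [vert_facePerm]
  exact ⟨d.1, by simp [vert, h], by simp [vert, h]⟩

theorem adj_facePerm_of_false {d : E × Bool} (h : d.2 = false) :
    G.Adj (G.vert (G.facePerm d)) (G.vert d) := by
  rw [vert_facePerm]
  exact ⟨d.1, by simp [vert, h], by simp [vert, h]⟩

/-- In an acyclic graph, no face is bounded by a directed closed walk. -/
theorem exists_sameCycle_facePerm_snd [Finite E] (hac : ∀ v, ¬ Relation.TransGen G.Adj v v)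
    (d : E × Bool) (b : Bool) : ∃ z, G.facePerm.SameCycle d z ∧ z.2 = b := by
  by_contra! hc
  have hpow : ∀ n : ℕ, ((G.facePerm ^ n) d).2 = !b := fun n => by
    exact Bool.eq_not_of_ne (hc ((G.facePerm ^ n) d) ⟨n, by rw [zpow_natCast]⟩)
  have hstep : ∀ n : ℕ, (G.facePerm ^ (n + 1)) d = G.facePerm ((G.facePerm ^ n) d) := fun n => by
    rw [pow_succ', mul_apply]
  have hpos := orderOf_pos G.facePerm
  obtain ⟨m, hm⟩ := Nat.exists_eq_add_one.2 hpos
  have hend : (G.facePerm ^ (m + 1)) d = d := by rw [← hm, pow_orderOf_eq_one]; rfl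
  cases b with
  | false =>
    have key : ∀ n : ℕ, Relation.TransGen G.Adj (G.vert d) (G.vert ((G.facePerm ^ (n + 1)) d)) := by
      intro n
      induction n with
      | zero => exact .single (hstep 0 ▸ adj_facePerm_of_true (hpow 0))
      | succ n ih => exact ih.tail (hstep (n + 1) ▸ adj_facePerm_of_true (hpow (n + 1)))
    exact hac _ (hend ▸ key m)
  | true =>
    have key : ∀ n : ℕ, Relation.TransGen G.Adj (G.vert ((G.facePerm ^ (n + 1)) d)) (G.vert d) := by
      intro n
      induction n with
      | zero => exact .single (hstep 0 ▸ adj_facePerm_of_false (hpow 0))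
      | succ n ih => exact .head (hstep (n + 1) ▸ adj_facePerm_of_false (hpow (n + 1))) ih
    have := key m
    rw [hend] at this
    exact hac _ this

/-- Every face has a corner whose darts are both outgoing and one whose darts are both incoming. -/
theorem exists_corner_face [Finite E] (hac : ∀ v, ¬ Relation.TransGen G.Adj v v)
    (b : Bool) (f : G.Face) : ∃ d, G.Corner b b d ∧ G.face d = f := by
  obtain ⟨d, rfl⟩ := G.face_surjective f
  obtain ⟨x, hx, hx2⟩ := exists_sameCycle_facePerm_snd hac d (!b)
  obtain ⟨y, hy, hy2⟩ := exists_sameCycle_facePerm_snd hac d b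
  obtain ⟨z, hz, h1, h2⟩ := SameCycle.exists_rise (fun z => z.2 == b) (hx.symm.trans hy)
    (by simp [hx2]) (by simp [hy2])
  refine ⟨z, ⟨?_, by simpa using h2⟩, G.face_eq_iff.2 (hx.trans hz).symm⟩
  -- A change of direction along the face is a corner with two equal directions: the face arrives
  -- along the flip of `G.rot⁻¹ z`.
  rw [beq_eq_false_iff_ne, facePerm_inv_snd] at h1
  simpa using Bool.eq_not_of_ne h1

/-- Every vertex with both incoming and outgoing edges has corners between an incoming and
an outgoing dart, in both orders. -/
theorem exists_corner_vert [Finite E] (b : Bool) {v : V} (h1 : ¬ G.IsSource v) (h2 : ¬ G.IsSink v) :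
    ∃ d, G.Corner (!b) b d ∧ G.vert d = v := by
  simp only [IsSource, IsSink, not_forall, not_not] at h1 h2
  obtain ⟨e, he⟩ := h1
  obtain ⟨f, rfl⟩ := h2
  have key : ∀ b, ∃ d : E × Bool, G.vert d = G.src f ∧ d.2 = b := by
    rintro (_ | _)
    · exact ⟨(e, false), he, rfl⟩
    · exact ⟨(f, true), rfl, rfl⟩
  obtain ⟨x, hx, hx2⟩ := key (!b)
  obtain ⟨y, hy, hy2⟩ := key b
  obtain ⟨z, hz, h1, h2⟩ := SameCycle.exists_rise (fun z => z.2 == b)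
    (G.vert_eq_iff.1 (hx.trans hy.symm)) (by simp [hx2]) (by simp [hy2])
  refine ⟨z, ⟨Bool.eq_not_of_ne (beq_eq_false_iff_ne.1 h1), by simpa using h2⟩, ?_⟩
  rw [← hx]; exact G.vert_eq_iff.2 hz.symm

theorem card_corners [Finite E] : Nat.card {d // G.Corner true true d} +
    Nat.card {d // G.Corner false false d} + Nat.card {d // G.Corner false true d} +
    Nat.card {d // G.Corner true false d} = 2 * Nat.card E := by
  classical
  have := Fintype.ofFinite E
  simp only [Nat.card_eq_fintype_card, Fintype.card_subtype, Corner]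
  have h : (Finset.univ : Finset (E × Bool)).card = 2 * Fintype.card E := by
    simp [Fintype.card_prod, mul_comm]
  rw [← h, ← Finset.card_filter_add_card_filter_not (s := Finset.univ)
      (fun d : E × Bool => (G.rot⁻¹ d).2 = true),
    ← Finset.card_filter_add_card_filter_not (s := Finset.univ.filter
      (fun d : E × Bool => (G.rot⁻¹ d).2 = true))
      (fun d : E × Bool => d.2 = true),
    ← Finset.card_filter_add_card_filter_not (s := Finset.univ.filter
      (fun d : E × Bool => ¬ (G.rot⁻¹ d).2 = true))
      (fun d : E × Bool => d.2 = true)]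
  simp only [Finset.filter_filter, Bool.not_eq_true]
  ring

namespace IsPlanarST

variable {s t : V} (hG : G.IsPlanarST s t)
include hG

theorem source_ne_sink : s ≠ t := by
  rintro rfl
  obtain ⟨⟨e, b⟩, hd, -⟩ := hG.source_outer
  cases b with
  | true => exact (hG.sink_iff s).2 rfl e hd
  | false => exact (hG.source_iff s).2 rfl e hd

/-- There are 2|E| corners. Each face has at least one source and one sink corner, and each vertex
other than `s`, `t` at least one corner of each mixed kind. By Euler's formula these lower bounds
already add up to 2|F| + 2(|V| - 2) = 2|E|, so all of them are attained. -/
theorem corner_injective [Fintype V] [Finite E] :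
    (∀ b d d', G.Corner b b d → G.Corner b b d' → G.face d = G.face d' → d = d') ∧
    (∀ b d d', G.Corner (!b) b d → G.Corner (!b) b d' → G.vert d = G.vert d' → d = d') := by
  classical
  let W := {v : V // v ≠ s ∧ v ≠ t}
  have hW : Nat.card W + 2 = Nat.card V := by
    have h1 := Finset.card_filter_add_card_filter_not (s := (Finset.univ : Finset V))
      (fun v => v ≠ s ∧ v ≠ t)
    have h2 : (Finset.univ.filter fun v => ¬ (v ≠ s ∧ v ≠ t)) = {s, t} := by
      ext v; simp only [Finset.mem_filter, Finset.mem_univ, true_and, Finset.mem_insert,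
        Finset.mem_singleton]; tauto
    rw [h2, Finset.card_pair hG.source_ne_sink] at h1
    simpa [W, Nat.card_eq_fintype_card, Fintype.card_subtype] using h1
  have hvert : ∀ b (d : {d // G.Corner (!b) b d}), G.vert d.1 ≠ s ∧ G.vert d.1 ≠ t := by
    rintro b ⟨d, h1, h2⟩
    have key : ∃ d₁ d₂ : E × Bool, d₁.2 = true ∧ d₂.2 = false ∧ G.vert d₁ = G.vert d ∧
        G.vert d₂ = G.vert d := by
      cases b
      · exact ⟨_, d, h1, h2, G.vert_rot_inv d, rfl⟩
      · exact ⟨d, _, h2, h1, rfl, G.vert_rot_inv d⟩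
    obtain ⟨⟨e, _⟩, ⟨f, _⟩, rfl, rfl, he, hf⟩ := key
    exact ⟨fun h => (hG.source_iff s).2 rfl f (hf.trans h),
      fun h => (hG.sink_iff t).2 rfl e (he.trans h)⟩
  let F (b : Bool) : {d // G.Corner b b d} → G.Face := fun d => G.face d.1
  let N (b : Bool) : {d // G.Corner (!b) b d} → W := fun d => ⟨G.vert d.1, hvert b d⟩
  have hF : ∀ b, Function.Surjective (F b) := fun b f => by
    obtain ⟨d, hd, rfl⟩ := exists_corner_face hG.acyclic b f
    exact ⟨⟨d, hd⟩, rfl⟩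
  have hN : ∀ b, Function.Surjective (N b) := fun b ⟨v, hv1, hv2⟩ => by
    obtain ⟨d, hd, rfl⟩ := exists_corner_vert (G := G) (v := v) b
      (fun h => hv1 ((hG.source_iff v).1 h)) (fun h => hv2 ((hG.sink_iff v).1 h))
    exact ⟨⟨d, hd⟩, rfl⟩
  have cF := fun b => Nat.card_le_card_of_surjective _ (hF b)
  have cN := fun b => Nat.card_le_card_of_surjective _ (hN b)
  have hsum := G.card_corners
  have heuler := hG.plane.2
  -- The four lower bounds sum to the total, so each of them is also an upper bound.
  have cF' : ∀ b, Nat.card {d // G.Corner b b d} ≤ Nat.card G.Face := by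
    have h1 := cF true; have h2 := cF false; have h3 := cN true; have h4 := cN false
    simp only [Bool.not_true, Bool.not_false] at h3 h4
    rintro (_ | _) <;> omega
  have cN' : ∀ b, Nat.card {d // G.Corner (!b) b d} ≤ Nat.card W := by
    have h1 := cF true; have h2 := cF false; have h3 := cN true; have h4 := cN false
    simp only [Bool.not_true, Bool.not_false] at h3 h4
    rintro (_ | _) <;> simp only [Bool.not_true, Bool.not_false] <;> omega
  refine ⟨fun b d d' hd hd' h => ?_, fun b d d' hd hd' h => ?_⟩
  · have := ((hF b).bijective_of_nat_card_le (cF' b)).1 (a₁ := ⟨d, hd⟩) (a₂ := ⟨d', hd'⟩) h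
    exact congrArg Subtype.val this
  · have := ((hN b).bijective_of_nat_card_le (cN' b)).1 (a₁ := ⟨d, hd⟩) (a₂ := ⟨d', hd'⟩)
      (Subtype.ext h)
    exact congrArg Subtype.val this

end IsPlanarST

end EmbeddedDigraph

/-! ### Circulations and cocycles on the sphere -/

namespace EmbeddedDigraph

open Equiv.Perm

variable {V E : Type*} (G : EmbeddedDigraph V E)

/-- The differences of a function on the vertices along the edges. -/
def vertDiff : (V → ℚ) →ₗ[ℚ] (E → ℚ) where
  toFun y e := y (G.tgt e) - y (G.src e)
  map_add' y z := by ext e; simp only [Pi.add_apply]; ring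
  map_smul' c y := by ext e; simp only [Pi.smul_apply, smul_eq_mul, RingHom.id_apply]; ring

/-- The differences of a function on the faces across the edges, from left to right. -/
def faceDiff : (G.Face → ℚ) →ₗ[ℚ] (E → ℚ) where
  toFun φ e := φ (G.face (e, false)) - φ (G.face (e, true))
  map_add' y z := by ext e; simp only [Pi.add_apply]; ring
  map_smul' c y := by ext e; simp only [Pi.smul_apply, smul_eq_mul, RingHom.id_apply]; ring

theorem vertDiff_apply (y : V → ℚ) (e : E) : G.vertDiff y e = y (G.tgt e) - y (G.src e) := rfl

theorem faceDiff_apply (φ : G.Face → ℚ) (e : E) :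
    G.faceDiff φ e = φ (G.face (e, false)) - φ (G.face (e, true)) := rfl

theorem sum_darts [Fintype E] (f : E × Bool → ℚ) :
    ∑ d, f d = ∑ e, (f (e, true) + f (e, false)) := by
  rw [Fintype.sum_prod_type]
  simp

/-- Summation by parts over darts: the rotation keeps the vertex of a dart and sends its face to the
face on the other side of the old dart. -/
theorem vertDiff_dotProduct_faceDiff [Fintype E] (y : V → ℚ) (φ : G.Face → ℚ) :
    G.vertDiff y ⬝ᵥ G.faceDiff φ = 0 := by
  have h1 : ∑ d, y (G.vert d) * φ (G.face d) = ∑ d, y (G.vert d) * φ (G.face (dartFlip E d)) := by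
    rw [← Equiv.sum_comp G.rot]
    exact Finset.sum_congr rfl fun d _ => by rw [vert_rot, face_rot]; rfl
  rw [sum_darts, sum_darts, ← sub_eq_zero, ← Finset.sum_sub_distrib] at h1
  rw [dotProduct, ← h1]
  refine Finset.sum_congr rfl fun e _ => ?_
  simp only [vertDiff_apply, faceDiff_apply, vert_true, vert_false, dartFlip_apply, Bool.not_true,
    Bool.not_false]
  ring

variable {G}

theorem eq_of_vertDiff_eq_zero (hconn : ∀ u v, Relation.EqvGen G.Adj u v) {α : Type*} {y : V → α}
    (hy : ∀ e, y (G.tgt e) = y (G.src e)) (u v : V) : y u = y v := by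
  induction hconn u v with
  | rel u v h => obtain ⟨e, rfl, rfl⟩ := h; exact (hy e).symm
  | refl => rfl
  | symm _ _ _ ih => exact ih.symm
  | trans _ _ _ _ _ ih₁ ih₂ => exact ih₁.trans ih₂

/-- Consecutive darts at a vertex have the two sides of a common edge as their faces, so the value
is constant around each vertex; connectivity carries it from vertex to vertex. -/
theorem eq_of_faceDiff_eq_zero (hconn : ∀ u v, Relation.EqvGen G.Adj u v) {α : Type*}
    {φ : G.Face → α} (hφ : ∀ e, φ (G.face (e, false)) = φ (G.face (e, true))) (f g : G.Face) :
    φ f = φ g := by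
  have hflip : ∀ d : E × Bool, φ (G.face (d.1, !d.2)) = φ (G.face d) := by
    rintro ⟨e, _ | _⟩
    · exact (hφ e).symm
    · exact hφ e
  have hrot : ∀ d d', G.vert d = G.vert d' → φ (G.face d) = φ (G.face d') := fun d d' h =>
    (G.vert_eq_iff.1 h).eq_of_forall_step (fun d => φ (G.face d))
      fun d => by rw [face_rot, hflip]
  obtain ⟨d, rfl⟩ := G.face_surjective f
  obtain ⟨d', rfl⟩ := G.face_surjective g
  -- The alternative `u = v` is needed because reflexivity provides no dart at `u`.
  have key : ∀ u v, Relation.EqvGen G.Adj u v → u = v ∨ ∃ d d', G.vert d = u ∧ G.vert d' = v ∧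
      φ (G.face d) = φ (G.face d') := by
    intro u v h
    induction h with
    | rel u v h => obtain ⟨e, rfl, rfl⟩ := h; exact .inr ⟨(e, true), (e, false), rfl, rfl, (hφ e).symm⟩
    | refl => exact .inl rfl
    | symm _ _ _ ih =>
      obtain rfl | ⟨d, d', h1, h2, h3⟩ := ih
      · exact .inl rfl
      · exact .inr ⟨d', d, h2, h1, h3.symm⟩
    | trans _ _ _ _ _ ih₁ ih₂ =>
      obtain rfl | ⟨d₁, d₂, h1, h2, h3⟩ := ih₁
      · exact ih₂
      obtain rfl | ⟨d₃, d₄, h4, h5, h6⟩ := ih₂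
      · exact .inr ⟨d₁, d₂, h1, h2, h3⟩
      · exact .inr ⟨d₁, d₄, h1, h5, h3.trans ((hrot _ _ (h2.trans h4.symm)).trans h6)⟩
  obtain h | ⟨d₁, d₂, h1, h2, h3⟩ := key _ _ (hconn (G.vert d) (G.vert d'))
  · exact hrot _ _ h
  · exact (hrot _ _ h1.symm).trans (h3.trans (hrot _ _ h2))

end EmbeddedDigraph

theorem card_le_finrank_range_add_one {α β : Type*} [Fintype α] [Finite β]
    (f : (α → ℚ) →ₗ[ℚ] (β → ℚ)) (h : ∀ y, f y = 0 → ∀ a b, y a = y b) :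
    Fintype.card α ≤ Module.finrank ℚ f.range + 1 := by
  have h1 := f.finrank_range_add_finrank_ker
  rw [Module.finrank_fintype_fun_eq_card] at h1
  have h2 : f.ker ≤ Submodule.span ℚ {fun _ => 1} := fun y hy => by
    rw [Submodule.mem_span_singleton]
    rcases isEmpty_or_nonempty α with hα | ⟨⟨a⟩⟩
    · exact ⟨0, Subsingleton.elim _ _⟩
    · exact ⟨y a, by ext b; simp [h y hy a b]⟩
  have h3 := Submodule.finrank_mono h2
  have h4 := finrank_span_le_card (R := ℚ) ({fun _ => 1} : Set (α → ℚ))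
  rw [Set.toFinset_singleton, Finset.card_singleton] at h4
  omega

/-- The dot product over `ℚ` is definite, so the orthogonal complement of `B` meets `B` trivially.
The dimension bound leaves no room between `A` and that complement. -/
theorem mem_of_dotProduct_eq_zero {ι : Type*} [Fintype ι] {A B : Submodule ℚ (ι → ℚ)}
    (horth : ∀ a ∈ A, ∀ b ∈ B, a ⬝ᵥ b = 0)
    (hcard : Fintype.card ι ≤ Module.finrank ℚ A + Module.finrank ℚ B) {z : ι → ℚ}
    (hz : ∀ b ∈ B, z ⬝ᵥ b = 0) : z ∈ A := by
  let C : Submodule ℚ (ι → ℚ) :=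
    { carrier := {z | ∀ b ∈ B, z ⬝ᵥ b = 0}
      add_mem' := fun {x y} hx hy b hb => by rw [add_dotProduct, hx b hb, hy b hb, add_zero]
      zero_mem' := fun b _ => zero_dotProduct b
      smul_mem' := fun c x hx b hb => by rw [smul_dotProduct, hx b hb, smul_zero] }
  have hAC : A ≤ C := horth
  have hdisj : Disjoint C B := Submodule.disjoint_def.2 fun x hx hx' =>
    dotProduct_self_eq_zero.1 (hx x hx')
  have h1 := Submodule.finrank_add_finrank_le_of_disjoint hdisj
  rw [Module.finrank_fintype_fun_eq_card] at h1
  have h2 : A = C := Submodule.eq_of_le_of_finrank_le hAC (by omega)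
  rw [h2]; exact hz

namespace EmbeddedDigraph

variable {V E : Type*} {G : EmbeddedDigraph V E}

/-- By connectivity both kernels consist of constants, so the ranks are at least |V| - 1 and |F| -
1; these add up to |E| by Euler's formula. -/
theorem IsPlane.card_le_finrank [Fintype V] [Fintype E] (h : G.IsPlane) : Fintype.card E ≤
    Module.finrank ℚ G.vertDiff.range + Module.finrank ℚ G.faceDiff.range := by
  have := Fintype.ofFinite G.Face
  have h1 := card_le_finrank_range_add_one G.vertDiff fun y hy =>
    eq_of_vertDiff_eq_zero h.1 fun e => sub_eq_zero.1 (congrFun hy e)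
  have h2 := card_le_finrank_range_add_one G.faceDiff fun y hy =>
    eq_of_faceDiff_eq_zero h.1 fun e => sub_eq_zero.1 (congrFun hy e)
  have h3 := h.2
  simp only [Nat.card_eq_fintype_card] at h3
  omega

/-- On the sphere, every cocycle is a coboundary. -/
theorem IsPlane.exists_vertDiff_eq [Fintype V] [Fintype E] (h : G.IsPlane) {z : E → ℚ}
    (hz : ∀ φ, z ⬝ᵥ G.faceDiff φ = 0) : ∃ y, G.vertDiff y = z := by
  refine mem_of_dotProduct_eq_zero (A := G.vertDiff.range) (B := G.faceDiff.range) ?_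
    h.card_le_finrank ?_
  · rintro _ ⟨y, rfl⟩ _ ⟨φ, rfl⟩
    exact G.vertDiff_dotProduct_faceDiff y φ
  · rintro _ ⟨φ, rfl⟩
    exact hz φ

/-- On the sphere, every circulation is a boundary. -/
theorem IsPlane.exists_faceDiff_eq [Fintype V] [Fintype E] (h : G.IsPlane) {z : E → ℚ}
    (hz : ∀ y, z ⬝ᵥ G.vertDiff y = 0) : ∃ φ, G.faceDiff φ = z := by
  refine mem_of_dotProduct_eq_zero (A := G.faceDiff.range) (B := G.vertDiff.range) ?_
    (by rw [add_comm]; exact h.card_le_finrank) ?_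
  · rintro _ ⟨y, rfl⟩ _ ⟨φ, rfl⟩
    rw [dotProduct_comm]
    exact G.vertDiff_dotProduct_faceDiff φ y
  · rintro _ ⟨φ, rfl⟩
    exact hz φ

end EmbeddedDigraph

/-- A directed walk yields a nonnegative flow from its start to its end. -/
theorem exists_flow_of_transGen {A B : Type*} [Fintype B] {s t : B → A} {P : B → Prop} {a c : A}
    (h : Relation.TransGen (fun a c => ∃ b, P b ∧ s b = a ∧ t b = c) a c) :
    ∃ z : B → ℚ, 0 ≤ z ∧ z ≠ 0 ∧ (∀ b, ¬ P b → z b = 0) ∧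
      ∀ g : A → ℚ, ∑ b, z b * (g (t b) - g (s b)) = g c - g a := by
  classical
  have hs : ∀ (b : B) (g : A → ℚ), ∑ b', (Pi.single b 1 : B → ℚ) b' * (g (t b') - g (s b')) =
      g (t b) - g (s b) := fun b g => by simp [Pi.single_apply]
  have hP : ∀ b, P b → ∀ b', ¬ P b' → (Pi.single b 1 : B → ℚ) b' = 0 := fun b hb b' hb' =>
    Pi.single_eq_of_ne (fun h => hb' (by rwa [h])) _
  have h0 : ∀ b : B, (0 : B → ℚ) ≤ Pi.single b 1 := fun b => by simp
  induction h with
  | single h =>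
    obtain ⟨b, hb, rfl, rfl⟩ := h
    exact ⟨Pi.single b 1, h0 b, by simp, hP b hb, hs b⟩
  | tail _ h ih =>
    obtain ⟨b, hb, rfl, rfl⟩ := h
    obtain ⟨z, hz, hz0, hzP, hzg⟩ := ih
    refine ⟨z + Pi.single b 1, add_nonneg hz (h0 b), fun h => hz0 ?_, fun b' hb' => ?_, fun g => ?_⟩
    · exact le_antisymm (by rw [← h]; exact le_add_of_nonneg_right (h0 b)) hz
    · rw [Pi.add_apply, hzP b' hb', hP b hb b' hb', add_zero]
    · simp only [Pi.add_apply, add_mul, Finset.sum_add_distrib]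
      rw [hzg, hs]; ring

/-! ### Acyclicity of the dual graph -/

namespace EmbeddedDigraph.IsPlanarST

variable {V E : Type*} {G : EmbeddedDigraph V E} {s t : V} (hG : G.IsPlanarST s t)
include hG

theorem reflTransGen_source [Finite V] (v : V) : Relation.ReflTransGen G.Adj s v := by
  have hwf : WellFounded (Relation.TransGen G.Adj) :=
    have : Std.Irrefl (Relation.TransGen G.Adj) := ⟨hG.acyclic⟩
    Finite.wellFounded_of_trans_of_irrefl _
  induction v using hwf.induction with
  | _ v ih =>
    by_cases hv : v = s
    · rw [hv]
    · rw [← hG.source_iff, IsSource] at hv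
      push Not at hv
      obtain ⟨e, rfl⟩ := hv
      exact (ih _ (.single ⟨e, rfl, rfl⟩)).tail ⟨e, rfl, rfl⟩

theorem reflTransGen_sink [Finite V] (v : V) : Relation.ReflTransGen G.Adj v t := by
  have hwf : WellFounded (Function.swap (Relation.TransGen G.Adj)) :=
    have : Std.Irrefl (Function.swap (Relation.TransGen G.Adj)) := ⟨hG.acyclic⟩
    Finite.wellFounded_of_trans_of_irrefl _
  induction v using hwf.induction with
  | _ v ih =>
    by_cases hv : v = t
    · rw [hv]
    · rw [← hG.sink_iff, IsSink] at hv
      push Not at hv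
      obtain ⟨e, rfl⟩ := hv
      exact .head ⟨e, rfl, rfl⟩ (ih _ (.single ⟨e, rfl, rfl⟩))

/-- The dual graph without the outer face, directed from left to right, is acyclic. -/
theorem dual_acyclic [Fintype V] [Finite E] (f : G.Face) :
    ¬ Relation.TransGen (fun f g => ∃ e, (¬ G.OnOuter (e, true) ∧ ¬ G.OnOuter (e, false)) ∧
      G.face (e, true) = f ∧ G.face (e, false) = g) f f := by
  have := Fintype.ofFinite E
  intro h
  obtain ⟨z, hz, hz0, hzP, hzg⟩ := exists_flow_of_transGen h
  -- A closed dual walk is a cocycle, so it comes from a vertex potential `y`. As `z` is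
  -- nonnegative, `y` grows along edges; as `z` vanishes on the outer boundary, `y` agrees at `s`
  -- and `t`. Every vertex lies between these, so `y` is constant.
  obtain ⟨y, rfl⟩ := hG.plane.exists_vertDiff_eq (z := z) fun φ => by
    simpa [dotProduct, faceDiff_apply] using hzg φ
  have hmono : ∀ u v, Relation.ReflTransGen G.Adj u v → y u ≤ y v := by
    intro u v huv
    induction huv with
    | refl => rfl
    | tail _ h ih =>
      obtain ⟨e, rfl, rfl⟩ := h
      exact ih.trans (sub_nonneg.1 (hz e))
  have hout : ∀ d, G.OnOuter d → y (G.vert d) = y (G.vert (d.1, !d.2)) := by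
    rintro ⟨e, b⟩ hd
    have : y (G.tgt e) = y (G.src e) := sub_eq_zero.1 (hzP e fun h => by
      cases b
      exacts [h.2 hd, h.1 hd])
    cases b
    · exact this
    · exact this.symm
  have hcyc : ∀ d, G.OnOuter d → y (G.vert d) = y (G.vert G.outer) := by
    intro d hd
    obtain ⟨k, rfl⟩ := hd
    induction k with
    | zero => rfl
    | succ n ih =>
      rw [add_comm, zpow_add, zpow_one, Equiv.Perm.mul_apply, vert_facePerm, ← hout _ ⟨_, rfl⟩, ih]
    | pred n ih =>
      rw [← ih, hout _ ⟨_, rfl⟩, ← vert_facePerm, ← Equiv.Perm.mul_apply, mul_self_zpow, sub_add_cancel]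
  obtain ⟨d, rfl, hd⟩ := hG.source_outer
  obtain ⟨d', rfl, hd'⟩ := hG.sink_outer
  have hst : y (G.vert d) = y (G.vert d') := (hcyc d hd).trans (hcyc d' hd').symm
  have hconst : ∀ v, y v = y (G.vert d) := fun v => le_antisymm
    ((hmono _ _ (hG.reflTransGen_sink v)).trans hst.ge) (hmono _ _ (hG.reflTransGen_source v))
  refine hz0 (funext fun e => ?_)
  rw [vertDiff_apply, hconst, hconst (G.src e), sub_self]; rfl

end EmbeddedDigraph.IsPlanarST

/-! ### Acyclicity with arcs between consecutive successors -/

namespace EmbeddedDigraph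

open Equiv.Perm

variable {V E : Type*} (G : EmbeddedDigraph V E)

/-- The edge `e` alone is the left boundary of an inner face. -/
def IsLeftBoundary (e : E) : Prop :=
  (G.rot (e, true)).2 = true ∧ (G.rot⁻¹ (e, false)).2 = false ∧ ¬ G.OnOuter (e, false)

/-- The edges `e` and `f` have the same source, `f` follows `e` clockwise around it, and the face
between them is an inner face. -/
def Next (e f : E) : Prop := G.rot (e, true) = (f, true) ∧ ¬ G.OnOuter (f, true)

/-- There is an edge from `u` to `v`, or `v` follows `u` in the list of successors of a vertex. -/
def AdjOrNext (u v : V) : Prop := G.Adj u v ∨ ∃ e f, G.Next e f ∧ G.tgt e = u ∧ G.tgt f = v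

variable {G}

theorem sum_eq_sum_true [Fintype E] {f : E × Bool → ℚ} (hf : ∀ e, f (e, false) = 0) :
    ∑ d, f d = ∑ e, f (e, true) := by
  rw [sum_darts]; simp [hf]

/-- A potential on the faces that satisfies the inequalities arising from a closed walk vanishes. -/
theorem IsPlanarST.potential_eq_zero [Fintype V] [Finite E] {s t : V} (hG : G.IsPlanarST s t)
    (hN : ∀ e, ¬ G.IsLeftBoundary e) {φ : G.Face → ℚ} {x : E × Bool → ℚ}
    (hout : ∀ d, G.OnOuter d → φ (G.face d) = 0) (hx : 0 ≤ x)
    (hxP : ∀ d, ¬ (G.Corner true true d ∧ ¬ G.OnOuter d) → x d = 0)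
    (hle : ∀ e, φ (G.face (e, true)) + x (e, true) ≤
      φ (G.face (e, false)) + x (G.rot (e, true))) :
    φ = 0 ∧ x = 0 := by
  set R := Relation.TransGen (fun f g : G.Face => ∃ e, (¬ G.OnOuter (e, true) ∧
    ¬ G.OnOuter (e, false)) ∧ G.face (e, true) = f ∧ G.face (e, false) = g)
  have hirr : ∀ f, ¬ R f f := hG.dual_acyclic
  have hwf : WellFounded R :=
    have : Std.Irrefl R := ⟨hirr⟩
    Finite.wellFounded_of_trans_of_irrefl _
  have hwf' : WellFounded (Function.swap R) :=
    have : Std.Irrefl (Function.swap R) := ⟨hirr⟩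
    Finite.wellFounded_of_trans_of_irrefl _
  have hO : ∀ {d d'}, G.face d = G.face d' → (G.OnOuter d ↔ G.OnOuter d') := fun h => by
    rw [onOuter_iff, onOuter_iff, h]
  have hlow : ∀ f, 0 ≤ φ f := by
    intro f
    induction f using hwf.induction with
    | _ f ih =>
      -- Here `e` is the last edge on the left path of `f`. It is not the whole path, so the corner
      -- after its start carries no `x` and the inequality passes nonnegativity from left to right.
      obtain ⟨⟨e, b⟩, ⟨h1, rfl⟩, rfl⟩ := exists_corner_face hG.acyclic false f
      by_cases hf : G.OnOuter (e, false)
      · exact (hout _ hf).ge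
      have h2 : x (G.rot (e, true)) = 0 := hxP _ fun h => hN e ⟨h.1.2, h1, hf⟩
      have h3 := hle e
      have h4 : 0 ≤ φ (G.face (e, true)) := by
        by_cases he : G.OnOuter (e, true)
        · exact (hout _ he).ge
        · exact ih _ (.single ⟨e, ⟨he, hf⟩, rfl, rfl⟩)
      have := hx (e, true)
      simp only [Pi.zero_apply] at this
      linarith
  have hup : ∀ f d, G.face d = f → φ f + x d ≤ 0 := by
    intro f
    induction f using hwf'.induction with
    | _ f ih =>
      rintro d hd
      by_cases hf : G.OnOuter d
      · rw [← hd, hout _ hf, hxP d fun h => h.2 hf, add_zero]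
      -- Here `e` is the first edge on the right path of `f`, starting at its only source corner,
      -- where all of `x` on this face sits. The upper bound passes from right to left.
      obtain ⟨⟨e, b⟩, h0, rfl⟩ := exists_corner_face hG.acyclic true f
      have hb := h0.2
      simp only at hb
      subst hb
      have h1 : x d ≤ x (e, true) := by
        by_cases hd' : G.Corner true true d
        · rw [hG.corner_injective.1 true d _ hd' h0 hd]
        · rw [hxP d fun h => hd' h.1]; exact hx _
      have h2 := hle e
      have h3 : G.face (G.rot (e, true)) = G.face (e, false) := G.face_rot _
      have h4 : φ (G.face (e, false)) + x (G.rot (e, true)) ≤ 0 := by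
        by_cases he : G.OnOuter (e, false)
        · rw [hout _ he, hxP _ fun h => h.2 ((hO h3).2 he), add_zero]
        · exact ih _ (.single ⟨e, ⟨fun h => hf ((hO hd).2 h), he⟩, rfl, rfl⟩) _ h3
      linarith
  have hφ : φ = 0 := by
    funext f
    obtain ⟨d, rfl⟩ := G.face_surjective f
    have h1 := hup _ d rfl
    have h2 := hx d
    simp only [Pi.zero_apply] at h2 ⊢
    exact le_antisymm (by linarith) (hlow _)
  refine ⟨hφ, le_antisymm (fun d => ?_) hx⟩
  simpa [hφ] using hup _ d rfl

/-- A `Next` arc from the head of `e` to the head of `f` can be replaced by going back along `e` and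
forward along `f`. This turns a closed walk into a circulation on `E`, whose face potential
satisfies the inequalities of `potential_eq_zero`. -/
theorem IsPlanarST.adjOrNext_acyclic [Fintype V] [Finite E] {s t : V} (hG : G.IsPlanarST s t)
    (hN : ∀ e, ¬ G.IsLeftBoundary e) (v : V) : ¬ Relation.TransGen G.AdjOrNext v v := by
  have := Fintype.ofFinite E
  intro h
  let P : E ⊕ (E × Bool) → Prop :=
    Sum.elim (fun _ => True) fun d => G.Corner true true d ∧ ¬ G.OnOuter d
  let src : E ⊕ (E × Bool) → V := Sum.elim G.src fun d => G.tgt (G.rot⁻¹ d).1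
  let tgt : E ⊕ (E × Bool) → V := Sum.elim G.tgt fun d => G.tgt d.1
  have h' : Relation.TransGen (fun a c => ∃ b, P b ∧ src b = a ∧ tgt b = c) v v := by
    refine Relation.TransGen.mono ?_ _ _ h
    rintro _ _ (⟨e, rfl, rfl⟩ | ⟨e, f, ⟨hef, hf⟩, rfl, rfl⟩)
    · exact ⟨.inl e, trivial, rfl, rfl⟩
    · have hr : G.rot⁻¹ (f, true) = (e, true) := by rw [← hef, inv_apply_apply]
      exact ⟨.inr (f, true), ⟨⟨by rw [hr], rfl⟩, hf⟩, by simp only [src, Sum.elim_inr, hr], rfl⟩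
  obtain ⟨w, hw, hw0, hwP, hwg⟩ := exists_flow_of_transGen h'
  let z : E → ℚ := fun e => w (.inl e)
  let x : E × Bool → ℚ := fun d => w (.inr d)
  have hx : 0 ≤ x := fun d => hw _
  have hxP : ∀ d, ¬ (G.Corner true true d ∧ ¬ G.OnOuter d) → x d = 0 := fun d hd => hwP (.inr d) hd
  -- `z e` counts direct uses of `e`, `x (e, true)` its forward uses as the second edge of a `Next`
  -- pair, and `x (G.rot (e, true))` its backward uses as the first.
  obtain ⟨φ, hφ⟩ := hG.plane.exists_faceDiff_eq
    (z := fun e => z e + x (e, true) - x (G.rot (e, true))) fun g => by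
      have h1 := hwg g
      rw [Fintype.sum_sum_type, sub_self] at h1
      have h2 : ∑ d, x d * (g (G.tgt d.1) - g (G.tgt (G.rot⁻¹ d).1)) =
          ∑ d, x d * G.vertDiff g d.1 - ∑ d, x (G.rot d) * G.vertDiff g d.1 := by
        rw [← Equiv.sum_comp G.rot⁻¹ (fun d => x (G.rot d) * G.vertDiff g d.1),
          ← Finset.sum_sub_distrib]
        refine Finset.sum_congr rfl fun d _ => ?_
        rw [apply_inv_apply]
        by_cases hd : G.Corner true true d
        · have h3 : G.src d.1 = G.src (G.rot⁻¹ d).1 := by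
            have := G.vert_rot_inv d
            simp only [vert, hd.1, hd.2, cond_true] at this
            exact this.symm
          rw [vertDiff_apply, vertDiff_apply, h3]; ring
        · rw [hxP d fun h => hd h.1]; ring
      rw [sum_eq_sum_true (f := fun d => x d * G.vertDiff g d.1) fun e => by
          rw [hxP _ fun h => Bool.false_ne_true h.1.2, zero_mul],
        sum_eq_sum_true (f := fun d => x (G.rot d) * G.vertDiff g d.1) fun e => by
          rw [hxP _ fun h => Bool.false_ne_true (by simpa only [inv_apply_apply] using h.1.1),
            zero_mul]] at h2
      have h3 : ∑ e, z e * G.vertDiff g e +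
          ∑ d, x d * (g (G.tgt d.1) - g (G.tgt (G.rot⁻¹ d).1)) = 0 := h1
      rw [h2] at h3
      simp only [dotProduct, sub_mul, add_mul, Finset.sum_sub_distrib, Finset.sum_add_distrib]
      linarith
  -- The potential is shifted to vanish on the outer face; dropping `z e ≥ 0` from the equation
  -- leaves the required inequality.
  obtain ⟨h1, h2⟩ := hG.potential_eq_zero hN (φ := fun f => φ f - φ (G.face G.outer)) (x := x)
    (fun d hd => by rw [G.onOuter_iff.1 hd, sub_self]) hx hxP fun e => by
      have h1 := congrFun hφ e
      have h2 : 0 ≤ z e := hw _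
      simp only [faceDiff_apply] at h1
      linarith
  refine hw0 (funext fun b => ?_)
  cases b with
  | inr d => exact congrFun h2 d
  | inl e =>
    have h3 := congrFun hφ e
    have h4 : ∀ f, φ f - φ (G.face G.outer) = 0 := congrFun h1
    simp only [faceDiff_apply, h2, Pi.zero_apply] at h3
    have h5 := h4 (G.face (e, false))
    have h6 := h4 (G.face (e, true))
    change z e = 0
    linarith

end EmbeddedDigraph

/-! ### Monotone orderings and successor lists -/

theorem exists_equiv_fin_of_acyclic {α : Type*} [Fintype α] {R : α → α → Prop}
    (h : ∀ a, ¬ Relation.TransGen R a a) :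
    ∃ π : α ≃ Fin (Fintype.card α), ∀ a b, R a b → π a < π b := by
  classical
  have : IsPartialOrder α (Relation.ReflTransGen R) :=
    { refl := fun _ => .refl
      trans := fun _ _ _ => .trans
      antisymm := fun a b hab hba => by
        by_contra hne
        obtain rfl | hab' := Relation.reflTransGen_iff_eq_or_transGen.1 hab
        · exact hne rfl
        · exact h _ (hab'.trans_left hba) }
  obtain ⟨S, hS, hle⟩ := extend_partialOrder (Relation.ReflTransGen R)
  let : LinearOrder α :=
    { le := S
      le_refl := hS.refl
      le_trans := hS.trans
      le_antisymm := hS.antisymm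
      le_total := hS.total
      toDecidableLE := Classical.decRel _ }
  refine ⟨(monoEquivOfFin α rfl).symm.toEquiv, fun a b hab => ?_⟩
  have h1 : a < b := lt_of_le_of_ne (hle _ _ (.single hab)) fun hab' => h a (.single (hab' ▸ hab))
  exact (monoEquivOfFin α rfl).symm.lt_iff_lt.2 h1

namespace EmbeddedDigraph

open Equiv.Perm

variable {V E : Type*} {G : EmbeddedDigraph V E}

theorem IsPlanarST.isSTOrdering [Fintype V] {s t : V} (hG : G.IsPlanarST s t)
    {π : V ≃ Fin (Fintype.card V)} (hπ : ∀ e, π (G.src e) < π (G.tgt e)) :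
    G.IsSTOrdering s t π := by
  have hmono : ∀ u v, Relation.ReflTransGen G.Adj u v → π u ≤ π v := by
    intro u v huv
    induction huv with
    | refl => exact le_rfl
    | tail _ h ih =>
      obtain ⟨e, rfl, rfl⟩ := h
      exact ih.trans (hπ e).le
  exact ⟨fun v => hmono _ _ (hG.reflTransGen_source v),
    fun v => hmono _ _ (hG.reflTransGen_sink v), hπ⟩

theorem IsPlanarST.exists_monotone_ordering [Fintype V] [Finite E] {s t : V}
    (hG : G.IsPlanarST s t) (hN : ∀ e, ¬ G.IsLeftBoundary e) :
    ∃ π, G.IsSTOrdering s t π ∧ ∀ e f, G.Next e f → π (G.tgt e) < π (G.tgt f) := by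
  obtain ⟨π, hπ⟩ := exists_equiv_fin_of_acyclic (hG.adjOrNext_acyclic hN)
  exact ⟨π, hG.isSTOrdering fun e => hπ _ _ (.inl ⟨e, rfl, rfl⟩),
    fun e f h => hπ _ _ (.inr ⟨e, f, h, rfl, rfl⟩)⟩

/-- The first outgoing dart in the list of successors of a vertex. -/
theorem IsPlanarST.exists_first [Fintype V] [Finite E] {s t : V} (hG : G.IsPlanarST s t) {u : V}
    (hu : ¬ G.IsSink u) : ∃ d₀ : E × Bool, G.vert d₀ = u ∧ d₀.2 = true ∧
      (∀ d, G.vert d = u → d.2 = true → d ≠ d₀ → G.Corner true true d ∧ ¬ G.OnOuter d) ∧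
      (G.IsSource u → G.OnOuter d₀) := by
  have hs : ∀ d, G.vert d = s → d.2 = true := by
    rintro ⟨e, b⟩ h
    cases b
    · exact absurd h ((hG.source_iff s).2 rfl e)
    · rfl
  obtain ⟨o, ho, hoo⟩ := hG.source_outer
  have hoc : G.Corner true true o := ⟨hs _ ((G.vert_rot_inv o).trans ho), hs _ ho⟩
  -- The outer face has only one source corner, and it lies at `s`.
  have hTT : ∀ d, G.Corner true true d → G.OnOuter d → d = o := fun d hd hdo =>
    hG.corner_injective.1 true d o hd hoc (by rw [G.onOuter_iff.1 hdo, G.onOuter_iff.1 hoo])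
  by_cases hus : u = s
  · subst hus
    refine ⟨o, ho, hs _ ho, fun d hd hd2 hne => ?_, fun _ => hoo⟩
    have : G.Corner true true d := ⟨hs _ ((G.vert_rot_inv d).trans hd), hd2⟩
    exact ⟨this, fun h => hne (hTT d this h)⟩
  · obtain ⟨d₀, hd, hdu⟩ := exists_corner_vert true (fun h => hus ((hG.source_iff u).1 h)) hu
    refine ⟨d₀, hdu, hd.2, fun d hd' hd2 hne => ?_, fun h => absurd ((hG.source_iff u).1 h) hus⟩
    have : G.Corner true true d := by
      refine ⟨?_, hd2⟩
      by_contra h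
      exact hne (hG.corner_injective.2 true d d₀ ⟨by simpa using h, hd2⟩ hd (hd'.trans hdu.symm))
    refine ⟨this, fun h => hus ?_⟩
    rw [← hd', hTT d this h, ho]

theorem IsPlanarST.exists_isOutList [Fintype V] [Finite E] {s t : V} (hG : G.IsPlanarST s t)
    (u : V) : ∃ L, G.IsOutList u L ∧ L.IsChain G.Next := by
  by_cases hu : G.IsSink u
  · exact ⟨[], ⟨.nil, fun e => by simpa using hu e, .nil, by simp⟩, .nil⟩
  obtain ⟨d₀, hd₀, hd₀t, hfirst, hsrc⟩ := hG.exists_first hu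
  -- The list runs clockwise from `d₀` up to the first incoming dart, or once around if all darts
  -- are outgoing.
  have hex : ∃ n : ℕ, 0 < n ∧ (((G.rot ^ n) d₀).2 = false ∨ (G.rot ^ n) d₀ = d₀) :=
    ⟨orderOf G.rot, orderOf_pos _, .inr (by rw [pow_orderOf_eq_one]; rfl)⟩
  obtain ⟨n, hn0, hnd, hmin⟩ : ∃ n : ℕ, 0 < n ∧ (((G.rot ^ n) d₀).2 = false ∨ (G.rot ^ n) d₀ = d₀) ∧
      ∀ i, 0 < i → i < n → ((G.rot ^ i) d₀).2 = true ∧ (G.rot ^ i) d₀ ≠ d₀ := by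
    classical
    refine ⟨Nat.find hex, (Nat.find_spec hex).1, (Nat.find_spec hex).2, fun i h0 hi => ?_⟩
    have := Nat.find_min hex hi
    push Not at this
    simpa using this h0
  have htrue : ∀ i, i < n → ((G.rot ^ i) d₀).2 = true := by
    intro i hi
    rcases Nat.eq_zero_or_pos i with rfl | h0
    · exact hd₀t
    · exact (hmin i h0 hi).1
  have hdart : ∀ i, i < n → (G.rot ^ i) d₀ = (((G.rot ^ i) d₀).1, true) := fun i hi =>
    Prod.ext rfl (htrue i hi)
  have hsucc : ∀ i, (G.rot ^ (i + 1)) d₀ = G.rot ((G.rot ^ i) d₀) := fun i => by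
    rw [pow_succ', Equiv.Perm.mul_apply]
  have hvert : ∀ i : ℕ, G.vert ((G.rot ^ i) d₀) = u := fun i => by
    rw [← hd₀]; exact (G.vert_eq_iff.2 ⟨i, by rw [zpow_natCast]⟩).symm
  have hnext : ∀ i, i + 1 < n → G.Next ((G.rot ^ i) d₀).1 ((G.rot ^ (i + 1)) d₀).1 := by
    intro i hi
    refine ⟨?_, ?_⟩
    · rw [← hdart i (by omega), ← hdart (i + 1) hi, hsucc]
    · rw [← hdart (i + 1) hi]
      exact (hfirst _ (hvert _) (htrue _ hi) (hmin _ (by omega) hi).2).2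
  have hchain : ((List.range n).map fun i => ((G.rot ^ i) d₀).1).IsChain G.Next := by
    rw [List.isChain_map]
    rw [List.isChain_iff_getElem]
    intro i hi
    simp only [List.getElem_range]
    exact hnext i (by simpa using hi)
  refine ⟨_, ⟨?_, fun e => ⟨fun he => ?_, fun he => ?_⟩, hchain.imp fun _ _ h => h.1,
    fun hs e he => ?_⟩, hchain⟩
  · refine List.Nodup.map_on ?_ List.nodup_range
    have key : ∀ i j, i < j → j < n → ((G.rot ^ i) d₀).1 ≠ ((G.rot ^ j) d₀).1 := by
      intro i j hij hj h
      have h1 : (G.rot ^ i) d₀ = (G.rot ^ j) d₀ := by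
        rw [hdart i (by omega), hdart j hj, h]
      obtain ⟨k, rfl⟩ := Nat.exists_eq_add_of_lt hij
      rw [add_assoc, pow_add, Equiv.Perm.mul_apply] at h1
      exact (hmin (k + 1) (by omega) (by omega)).2 ((G.rot ^ i).injective h1).symm
    intro i hi j hj h
    rw [List.mem_range] at hi hj
    rcases lt_trichotomy i j with hij | hij | hij
    · exact absurd h (key i j hij hj)
    · exact hij
    · exact absurd h.symm (key j i hij hi)
  · obtain ⟨i, hi, rfl⟩ := List.mem_map.1 he
    rw [← hvert i, hdart i (List.mem_range.1 hi)]; rfl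
  -- An outgoing dart other than `d₀` is preceded by an outgoing dart, so no outgoing dart occurs
  -- after the gap before the rotation is back at `d₀`.
  · have key : ∀ k : ℕ, ((G.rot ^ k) d₀).2 = true → ∃ i < n, (G.rot ^ i) d₀ = (G.rot ^ k) d₀ := by
      intro k
      induction k with
      | zero => exact fun _ => ⟨0, hn0, rfl⟩
      | succ k ih =>
        intro hk
        by_cases h0 : (G.rot ^ (k + 1)) d₀ = d₀
        · exact ⟨0, hn0, h0.symm⟩
        have h1 := (hfirst _ (hvert _) hk h0).1.1
        rw [hsucc, inv_apply_apply] at h1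
        obtain ⟨i, hi, hik⟩ := ih h1
        rw [hsucc, ← hik, ← hsucc] at hk h0 ⊢
        by_cases hin : i + 1 < n
        · exact ⟨i + 1, hin, rfl⟩
        · obtain rfl : i + 1 = n := by omega
          rcases hnd with h | h
          · rw [h] at hk; exact absurd hk (by simp)
          · exact absurd h h0
    obtain ⟨k, hk⟩ := (G.vert_eq_iff.1 (hd₀.trans he.symm : G.vert d₀ = G.vert (e, true))).exists_nat_pow_eq
    obtain ⟨i, hi, hik⟩ := key k (by rw [hk])
    exact List.mem_map.2 ⟨i, List.mem_range.2 hi, by rw [hik, hk]⟩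
  · obtain ⟨m, rfl⟩ : ∃ m, n = m + 1 := Nat.exists_eq_add_one.2 hn0
    rw [List.range_succ_eq_map] at he
    simp only [List.map_cons, List.head?_cons, Option.mem_def, Option.some.injEq] at he
    have : (e, true) = d₀ := by rw [← he]; exact (hdart 0 hn0).symm
    rw [this]; exact hsrc hs

end EmbeddedDigraph

/-! ### Mirror images and bitonic orderings -/

namespace EmbeddedDigraph

open Equiv.Perm

variable {V E : Type*} (G : EmbeddedDigraph V E)

/-- The edge `e` alone is the right boundary of an inner face. -/
def IsRightBoundary (e : E) : Prop :=
  (G.rot⁻¹ (e, true)).2 = true ∧ (G.rot (e, false)).2 = false ∧ ¬ G.OnOuter (e, true)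

/-- The mirror image of an embedded graph. -/
def mirror : EmbeddedDigraph V E where
  src := G.src
  tgt := G.tgt
  rot := G.rot⁻¹
  sameCycle_rot_iff d d' := by rw [sameCycle_inv]; exact G.sameCycle_rot_iff d d'
  outer := dartFlip E G.outer

/-- Mirroring traverses each face backwards along the flipped darts. -/
theorem mirror_facePerm : G.mirror.facePerm = dartFlip E * G.facePerm⁻¹ * (dartFlip E)⁻¹ := by
  ext1 d
  rw [Equiv.Perm.mul_apply, Equiv.Perm.mul_apply]
  have h1 : (dartFlip E)⁻¹ d = dartFlip E d := by rw [inv_eq_iff_eq, dartFlip_dartFlip]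
  rw [h1, ← dartFlip_dartFlip (G.mirror.facePerm d)]
  rfl

theorem mirror_sameCycle_facePerm {d d' : E × Bool} :
    G.mirror.facePerm.SameCycle (dartFlip E d) (dartFlip E d') ↔ G.facePerm.SameCycle d d' := by
  rw [mirror_facePerm, sameCycle_conj, inv_apply_apply, inv_apply_apply, sameCycle_inv]

theorem mirror_onOuter {d : E × Bool} : G.mirror.OnOuter d ↔ G.OnOuter (dartFlip E d) := by
  rw [OnOuter, OnOuter, ← G.mirror_sameCycle_facePerm, dartFlip_dartFlip]; rfl

theorem card_mirror_face : Nat.card G.mirror.Face = Nat.card G.Face :=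
  (Nat.card_congr (Quotient.congr (dartFlip E) fun _ _ => G.mirror_sameCycle_facePerm.symm)).symm

variable {G}

theorem IsPlanarST.mirror {s t : V} (hG : G.IsPlanarST s t) : G.mirror.IsPlanarST s t where
  plane := ⟨hG.plane.1, by rw [card_mirror_face]; exact hG.plane.2⟩
  acyclic := hG.acyclic
  no_parallel := hG.no_parallel
  source_iff := hG.source_iff
  sink_iff := hG.sink_iff
  source_outer := by
    obtain ⟨d, hd, ho⟩ := hG.source_outer
    refine ⟨G.rot⁻¹ d, (G.vert_rot_inv d).trans hd, ?_⟩
    rw [mirror_onOuter]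
    rw [onOuter_iff] at ho ⊢
    rw [← ho, dartFlip_apply, ← face_rot, apply_inv_apply]
  sink_outer := by
    obtain ⟨d, hd, ho⟩ := hG.sink_outer
    refine ⟨G.rot⁻¹ d, (G.vert_rot_inv d).trans hd, ?_⟩
    rw [mirror_onOuter]
    rw [onOuter_iff] at ho ⊢
    rw [← ho, dartFlip_apply, ← face_rot, apply_inv_apply]

theorem IsPlanarST.exists_antitone_ordering [Fintype V] [Finite E] {s t : V}
    (hG : G.IsPlanarST s t) (hN : ∀ e, ¬ G.IsRightBoundary e) :
    ∃ π, G.IsSTOrdering s t π ∧ ∀ e f, G.Next e f → π (G.tgt f) < π (G.tgt e) := by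
  obtain ⟨π, hπ, hnext⟩ := hG.mirror.exists_monotone_ordering fun e ⟨h1, h2, h3⟩ =>
    hN e ⟨h1, by simpa [EmbeddedDigraph.mirror] using h2, fun h => h3 (G.mirror_onOuter.2 h)⟩
  refine ⟨π, hπ, fun e f ⟨h1, h2⟩ => hnext f e ⟨?_, fun h => h2 ?_⟩⟩
  · change G.rot⁻¹ (f, true) = _
    rw [← h1, inv_apply_apply]
  · rw [mirror_onOuter, onOuter_iff, dartFlip_apply, ← face_rot, h1] at h
    exact G.onOuter_iff.2 h

theorem isBitonic_of_isChain_lt {α : Type*} [LinearOrder α] {L : List α}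
    (h : L.IsChain (· < ·)) : IsBitonic L :=
  ⟨L.length, by rw [List.take_of_length_le (Nat.le_succ _)]; exact h.pairwise, by simp⟩

theorem isBitonic_of_isChain_gt {α : Type*} [LinearOrder α] {L : List α}
    (h : L.IsChain (· > ·)) : IsBitonic L :=
  ⟨0, by cases L <;> simp, by simpa using h.pairwise⟩

theorem IsPlanarST.exists_bitonic [Fintype V] [Finite E] {s t : V} (hG : G.IsPlanarST s t)
    (hN : (∀ e, ¬ G.IsLeftBoundary e) ∨ ∀ e, ¬ G.IsRightBoundary e) :
    ∃ π, G.IsBitonicSTOrdering s t π := by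
  rcases hN with hN | hN
  · obtain ⟨π, hπ, hnext⟩ := hG.exists_monotone_ordering hN
    refine ⟨π, hπ, fun u => ?_⟩
    obtain ⟨L, hL, hc⟩ := hG.exists_isOutList u
    exact ⟨L, hL, isBitonic_of_isChain_lt
      ((List.isChain_map _).2 (hc.imp fun e f h => hnext e f h))⟩
  · obtain ⟨π, hπ, hnext⟩ := hG.exists_antitone_ordering hN
    refine ⟨π, hπ, fun u => ?_⟩
    obtain ⟨L, hL, hc⟩ := hG.exists_isOutList u
    exact ⟨L, hL, isBitonic_of_isChain_gt
      ((List.isChain_map _).2 (hc.imp fun e f h => hnext e f h))⟩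

/-! ### Counting faces and single-edge boundaries -/

namespace IsPlanarST

variable {s t : V} (hG : G.IsPlanarST s t)
include hG

theorem facePerm_ne_self (d : E × Bool) : G.facePerm d ≠ d := by
  intro h
  have h1 := G.vert_facePerm d
  rw [h] at h1
  obtain ⟨e, b⟩ := d
  cases b
  · exact hG.acyclic _ (.single ⟨e, h1.symm, rfl⟩)
  · exact hG.acyclic _ (.single ⟨e, h1, rfl⟩)

/-- If both ends of `e` have degree one, then `e` starts at `s` and no path from `s` gets beyond its
head, which leaves only two vertices. -/
theorem not_isFixed [Fintype V] (hV : 3 ≤ Fintype.card V) {e : E} (h1 : G.rot (e, true) = (e, true))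
    (h2 : G.rot (e, false) = (e, false)) : False := by
  classical
  have hsrc : ∀ d, G.vert d = G.src e → d = (e, true) := fun d hd =>
    ((G.vert_eq_iff.1 (hd : G.vert d = G.vert (e, true))).symm.eq_of_left h1).symm
  have htgt : ∀ d, G.vert d = G.tgt e → d = (e, false) := fun d hd =>
    ((G.vert_eq_iff.1 (hd : G.vert d = G.vert (e, false))).symm.eq_of_left h2).symm
  have hs : G.src e = s := (hG.source_iff _).1 fun f hf => by
    simpa using hsrc (f, false) hf
  have hall : ∀ v, v = s ∨ v = G.tgt e := by
    intro v
    rcases (hG.reflTransGen_source v).cases_head with h | ⟨w, ⟨f, hf, rfl⟩, hw⟩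
    · exact .inl h.symm
    · have hfe : f = e := congrArg Prod.fst (hsrc (f, true) (hf.trans hs.symm))
      subst hfe
      rcases hw.cases_head with h | ⟨w, ⟨g, hg, rfl⟩, -⟩
      · exact .inr h.symm
      · simpa using htgt (g, true) hg
  have : (Finset.univ : Finset V) ⊆ {s, G.tgt e} := fun v _ => by simpa using hall v
  have := (Finset.card_le_card this).trans Finset.card_le_two
  rw [Finset.card_univ] at this
  omega

theorem facePerm_facePerm_ne_self [Fintype V] (hV : 3 ≤ Fintype.card V) (d : E × Bool) :
    G.facePerm (G.facePerm d) ≠ d := by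
  intro h
  have h1 := G.vert_facePerm d
  have h2 := G.vert_facePerm (G.facePerm d)
  rw [h] at h2
  -- A face that runs along an edge and straight back has ends of degree one. Any other face of
  -- length two is a directed 2-cycle or a pair of parallel edges.
  have key : G.facePerm d = (d.1, !d.2) → False := fun h3 => by
    rw [h3, facePerm_apply, Bool.not_not] at h
    rw [facePerm_apply] at h3
    obtain ⟨e, _ | _⟩ := d
    · exact hG.not_isFixed hV h3 h
    · exact hG.not_isFixed hV h h3
  generalize hd' : G.facePerm d = d' at h1 h2 key
  obtain ⟨e, b⟩ := d
  obtain ⟨e', b'⟩ := d'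
  cases b <;> cases b'
  · exact hG.acyclic _ (.tail (.single ⟨e, rfl, rfl⟩) ⟨e', h2.symm, h1⟩)
  · exact key (by rw [hG.no_parallel e' e h1 h2.symm]; rfl)
  · exact key (by rw [hG.no_parallel e' e h2.symm h1]; rfl)
  · exact hG.acyclic _ (.tail (.single ⟨e, rfl, rfl⟩) ⟨e', h1, h2.symm⟩)

theorem three_mul_card_face_le [Fintype V] [Finite E] (hV : 3 ≤ Fintype.card V) :
    3 * Nat.card G.Face ≤ 2 * Nat.card E := by
  classical
  have := Fintype.ofFinite E
  have := Fintype.ofFinite G.Face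
  have h1 : (Finset.univ : Finset (E × Bool)).card = 2 * Nat.card E := by
    simp [Fintype.card_prod, mul_comm]
  rw [← h1, Finset.card_eq_sum_card_fiberwise (f := G.face) (t := Finset.univ) (by simp),
    Nat.card_eq_fintype_card, mul_comm, ← smul_eq_mul]
  refine Finset.card_nsmul_le_sum _ _ _ fun f _ => ?_
  obtain ⟨d, rfl⟩ := G.face_surjective f
  have h3 : ({d, G.facePerm d, G.facePerm (G.facePerm d)} : Finset (E × Bool)).card = 3 :=
    Finset.card_eq_three.2 ⟨_, _, _, (hG.facePerm_ne_self d).symm,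
      (hG.facePerm_facePerm_ne_self hV d).symm, (hG.facePerm_ne_self _).symm, rfl⟩
  rw [← h3]
  refine Finset.card_le_card fun x hx => ?_
  simp only [Finset.mem_insert, Finset.mem_singleton] at hx
  simp only [Finset.mem_filter, Finset.mem_univ, true_and]
  rcases hx with rfl | rfl | rfl <;> simp only [face_facePerm]

theorem card_boundary_le [Fintype V] [Finite E] (hV : 3 ≤ Fintype.card V) :
    Nat.card {e // G.IsLeftBoundary e} + Nat.card {e // G.IsRightBoundary e} + 1 ≤
      Nat.card G.Face := by
  classical
  have := Fintype.ofFinite G.Face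
  have hinj := hG.corner_injective.1
  let l : {e // G.IsLeftBoundary e} → {f : G.Face // f ≠ G.face G.outer} :=
    fun e => ⟨G.face (e.1, false), fun h => e.2.2.2 (G.onOuter_iff.2 h)⟩
  let r : {e // G.IsRightBoundary e} → {f : G.Face // f ≠ G.face G.outer} :=
    fun e => ⟨G.face (e.1, true), fun h => e.2.2.2 (G.onOuter_iff.2 h)⟩
  have hl : Function.Injective l := fun ⟨e, he⟩ ⟨f, hf⟩ h =>
    Subtype.ext (congrArg Prod.fst (hinj false (e, false) (f, false) ⟨he.2.1, rfl⟩ ⟨hf.2.1, rfl⟩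
      (congrArg Subtype.val h)))
  have hr : Function.Injective r := fun ⟨e, he⟩ ⟨f, hf⟩ h =>
    Subtype.ext (congrArg Prod.fst (hinj true (e, true) (f, true) ⟨he.1, rfl⟩ ⟨hf.1, rfl⟩
      (congrArg Subtype.val h)))
  -- Uniqueness of the source and sink corners of the common face makes `e` and `f` adjacent at both
  -- ends, hence parallel, hence equal; both ends of this edge then have degree one.
  have hlr : ∀ a b, l a ≠ r b := by
    rintro ⟨e, he⟩ ⟨f, hf⟩ h
    have hface : G.face (e, false) = G.face (f, true) := congrArg Subtype.val h
    have h1 : G.rot (e, true) = (f, true) := hinj true _ _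
      ⟨by rw [inv_apply_apply], he.1⟩ ⟨hf.1, rfl⟩ ((G.face_rot _).trans hface)
    have h2 : G.rot (f, false) = (e, false) := hinj false _ _
      ⟨by rw [inv_apply_apply], hf.2.1⟩ ⟨he.2.1, rfl⟩ ((G.face_rot _).trans hface.symm)
    have h3 := G.vert_rot (e, true)
    have h4 := G.vert_rot (f, false)
    rw [h1] at h3
    rw [h2] at h4
    obtain rfl := hG.no_parallel e f h3.symm h4
    exact hG.not_isFixed hV h1 h2
  have hcard := Nat.card_le_card_of_injective _ (hl.sumElim hr hlr)
  rw [Nat.card_sum] at hcard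
  have : Nat.card {f : G.Face // f ≠ G.face G.outer} = Nat.card G.Face - 1 := by
    simp [Nat.card_eq_fintype_card, Fintype.card_subtype_compl]
  have hpos : 0 < Nat.card G.Face := Nat.card_pos_iff.2 ⟨⟨G.face G.outer⟩, inferInstance⟩
  omega

end IsPlanarST

/-! ### Splitting edges -/

section Split

variable [DecidableEq E] (F : Finset E)

theorem split_rot_inl (d : E × Bool) :
    (G.split F).rot (splitDart F (.inl d)) = splitDart F (.inl (G.rot d)) := by
  simp [split, splitRot]

theorem split_rot_inr (d : F × Bool) :
    (G.split F).rot (splitDart F (.inr d)) = splitDart F (.inr (dartFlip F d)) := by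
  simp [split, splitRot]

theorem split_rot_inv_inl (d : E × Bool) :
    (G.split F).rot⁻¹ (splitDart F (.inl d)) = splitDart F (.inl (G.rot⁻¹ d)) := by
  rw [inv_eq_iff_eq, split_rot_inl, apply_inv_apply]

theorem split_rot_inv_inr (d : F × Bool) :
    (G.split F).rot⁻¹ (splitDart F (.inr d)) = splitDart F (.inr (dartFlip F d)) := by
  rw [inv_eq_iff_eq, split_rot_inr, dartFlip_dartFlip]

variable {F}

theorem splitDart_inl_true (e : E) : splitDart F (.inl (e, true)) = (.inl e, true) := rfl

theorem splitDart_inl_false {e : E} (h : e ∉ F) :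
    splitDart F (.inl (e, false)) = (.inl e, false) := dif_neg h

theorem splitDart_inl_false_of_mem (f : F) :
    splitDart F (.inl (f.1, false)) = (.inr f, false) := dif_pos f.2

theorem splitDart_inr_true (f : F) : splitDart F (.inr (f, true)) = (.inl f.1, false) := rfl

theorem splitDart_inr_false (f : F) : splitDart F (.inr (f, false)) = (.inr f, true) := rfl

theorem splitDart_inl_snd (d : E × Bool) : (splitDart F (.inl d)).2 = d.2 := by
  obtain ⟨e, _ | _⟩ := d
  · by_cases h : e ∈ F
    · rw [splitDart_inl_false_of_mem ⟨e, h⟩]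
    · rw [splitDart_inl_false h]
  · rfl

/-- The dart of the original graph that contains a dart of the split graph. -/
def unsplitDart (F : Finset E) (x : (E ⊕ F) × Bool) : E × Bool :=
  (x.1.elim id Subtype.val, x.2)

theorem unsplitDart_splitDart (d : E × Bool) : unsplitDart F (splitDart F (.inl d)) = d := by
  obtain ⟨e, _ | _⟩ := d
  · by_cases h : e ∈ F
    · rw [splitDart_inl_false_of_mem ⟨e, h⟩]; rfl
    · rw [splitDart_inl_false h]; rfl
  · rfl

theorem split_facePerm_inl_true (f : F) :
    (G.split F).facePerm (.inl f.1, true) = (.inr f, true) := by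
  rw [facePerm_apply]
  change (G.split F).rot (splitDart F (.inr (f, true))) = _
  rw [split_rot_inr]; rfl

theorem split_facePerm_inl_true_of_notMem {e : E} (h : e ∉ F) :
    (G.split F).facePerm (.inl e, true) = splitDart F (.inl (G.facePerm (e, true))) := by
  rw [facePerm_apply, facePerm_apply, ← split_rot_inl]
  exact congrArg _ (splitDart_inl_false h).symm

theorem split_facePerm_inl_false (e : E) :
    (G.split F).facePerm (.inl e, false) = splitDart F (.inl (G.facePerm (e, false))) := by
  rw [facePerm_apply, facePerm_apply, ← split_rot_inl]; rfl

theorem split_facePerm_inr_true (f : F) :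
    (G.split F).facePerm (.inr f, true) = splitDart F (.inl (G.facePerm (f.1, true))) := by
  rw [facePerm_apply, facePerm_apply, ← split_rot_inl]
  exact congrArg _ (splitDart_inl_false_of_mem f).symm

theorem split_facePerm_inr_false (f : F) :
    (G.split F).facePerm (.inr f, false) = (.inl f.1, false) := by
  rw [facePerm_apply]
  change (G.split F).rot (splitDart F (.inr (f, false))) = _
  rw [split_rot_inr]; rfl

theorem sameCycle_unsplitDart {x y : (E ⊕ F) × Bool} (h : (G.split F).facePerm.SameCycle x y) :
    G.facePerm.SameCycle (unsplitDart F x) (unsplitDart F y) := by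
  refine h.of_forall_step _ fun x => ?_
  have hstep : ∀ d, G.facePerm.SameCycle d (G.facePerm d) := fun d =>
    sameCycle_apply_right.2 (SameCycle.refl _ _)
  obtain ⟨e | f, _ | _⟩ := x
  · rw [split_facePerm_inl_false, unsplitDart_splitDart]; exact hstep _
  · by_cases he : e ∈ F
    · rw [split_facePerm_inl_true ⟨e, he⟩]; exact SameCycle.refl _ _
    · rw [split_facePerm_inl_true_of_notMem he, unsplitDart_splitDart]; exact hstep _
  · rw [split_facePerm_inr_false]; exact SameCycle.refl _ _
  · rw [split_facePerm_inr_true, unsplitDart_splitDart]; exact hstep _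

theorem split_sameCycle_facePerm {d d' : E × Bool} :
    (G.split F).facePerm.SameCycle (splitDart F (.inl d)) (splitDart F (.inl d')) ↔
      G.facePerm.SameCycle d d' := by
  refine ⟨fun h => by simpa only [unsplitDart_splitDart] using sameCycle_unsplitDart h, fun h =>
    h.of_forall_step (fun d => splitDart F (.inl d)) fun d => ?_⟩
  have hstep : ∀ d, (G.split F).facePerm.SameCycle d ((G.split F).facePerm d) := fun d =>
    sameCycle_apply_right.2 (SameCycle.refl _ _)
  obtain ⟨e, _ | _⟩ := d
  · rw [← split_facePerm_inl_false]
    by_cases he : e ∈ F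
    · rw [splitDart_inl_false_of_mem ⟨e, he⟩]
      refine (hstep _).trans ?_
      rw [split_facePerm_inr_false]; exact hstep _
    · rw [splitDart_inl_false he]; exact hstep _
  · rw [splitDart_inl_true]
    by_cases he : e ∈ F
    · refine (hstep _).trans ?_
      rw [split_facePerm_inl_true ⟨e, he⟩, ← split_facePerm_inr_true ⟨e, he⟩]
      exact hstep _
    · rw [← split_facePerm_inl_true_of_notMem he]; exact hstep _

theorem split_onOuter {d : E × Bool} :
    (G.split F).OnOuter (splitDart F (.inl d)) ↔ G.OnOuter d := split_sameCycle_facePerm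

theorem sameCycle_splitDart_unsplitDart (x : (E ⊕ F) × Bool) :
    (G.split F).facePerm.SameCycle (splitDart F (.inl (unsplitDart F x))) x := by
  have hstep : ∀ d, (G.split F).facePerm.SameCycle d ((G.split F).facePerm d) := fun d =>
    sameCycle_apply_right.2 (SameCycle.refl _ _)
  obtain ⟨e | f, _ | _⟩ := x
  · by_cases he : e ∈ F
    · have := hstep (.inr ⟨e, he⟩, false)
      rw [split_facePerm_inr_false] at this
      rwa [← splitDart_inl_false_of_mem] at this
    · change (G.split F).facePerm.SameCycle (splitDart F (.inl (e, false))) _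
      rw [splitDart_inl_false he]
  · exact SameCycle.refl _ _
  · change (G.split F).facePerm.SameCycle (splitDart F (.inl (f.1, false))) _
    rw [splitDart_inl_false_of_mem]
  · have := hstep (.inl f.1, true)
    rwa [split_facePerm_inl_true] at this

variable (G F) in
theorem card_split_face : Nat.card (G.split F).Face = Nat.card G.Face := by
  refine (Nat.card_eq_of_bijective (Quotient.map (fun d => splitDart F (.inl d))
    fun d d' h => split_sameCycle_facePerm.2 h : G.Face → (G.split F).Face) ⟨?_, ?_⟩).symm
  · intro f g h
    obtain ⟨d, rfl⟩ := G.face_surjective f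
    obtain ⟨d', rfl⟩ := G.face_surjective g
    exact G.face_eq_iff.2 (split_sameCycle_facePerm.1 ((G.split F).face_eq_iff.1 h))
  · intro f
    obtain ⟨x, rfl⟩ := (G.split F).face_surjective f
    exact ⟨G.face (unsplitDart F x),
      (G.split F).face_eq_iff.2 (sameCycle_splitDart_unsplitDart x)⟩

theorem split_tgt_inl {e : E} (h : e ∉ F) : (G.split F).tgt (.inl e) = .inl (G.tgt e) := dif_neg h

theorem split_tgt_inl_of_mem (f : F) : (G.split F).tgt (.inl f.1) = .inr f := dif_pos f.2

theorem split_connected (h : ∀ u v, Relation.EqvGen G.Adj u v) (u v : V ⊕ F) :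
    Relation.EqvGen (G.split F).Adj u v := by
  have hdummy : ∀ f : F, Relation.EqvGen (G.split F).Adj (.inl (G.src f.1)) (.inr f) := fun f =>
    .rel _ _ ⟨.inl f.1, rfl, split_tgt_inl_of_mem f⟩
  have hold : ∀ u v, Relation.EqvGen (G.split F).Adj (.inl u) (.inl v) := by
    intro u v
    induction h u v with
    | rel u v h =>
      obtain ⟨e, rfl, rfl⟩ := h
      by_cases he : e ∈ F
      · exact (hdummy ⟨e, he⟩).trans _ _ _ (.rel _ _ ⟨.inr ⟨e, he⟩, rfl, rfl⟩)
      · exact .rel _ _ ⟨.inl e, rfl, split_tgt_inl he⟩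
    | refl => exact .refl _
    | symm _ _ _ ih => exact ih.symm
    | trans _ _ _ _ _ ih₁ ih₂ => exact ih₁.trans _ _ _ ih₂
  have hrep : ∀ u : V ⊕ F, ∃ w, Relation.EqvGen (G.split F).Adj (.inl w) u := by
    rintro (u | f)
    · exact ⟨u, .refl _⟩
    · exact ⟨_, hdummy f⟩
  obtain ⟨a, ha⟩ := hrep u
  obtain ⟨b, hb⟩ := hrep v
  exact (ha.symm.trans _ _ _ (hold a b)).trans _ _ _ hb

theorem split_acyclic [Finite V] (h : ∀ v, ¬ Relation.TransGen G.Adj v v) (v : V ⊕ F) :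
    ¬ Relation.TransGen (G.split F).Adj v v := by
  have := Fintype.ofFinite V
  obtain ⟨π, hπ⟩ := exists_equiv_fin_of_acyclic h
  -- Doubling the ranks leaves an odd value just above the source for each dummy vertex.
  let r : V ⊕ F → ℕ := Sum.elim (fun v => 2 * (π v : ℕ)) fun f => 2 * (π (G.src f.1) : ℕ) + 1
  have hr : ∀ u v, (G.split F).Adj u v → r u < r v := by
    rintro _ _ ⟨e | f, rfl, rfl⟩
    · have h1 : (π (G.src e) : ℕ) < π (G.tgt e) := hπ _ _ ⟨e, rfl, rfl⟩
      by_cases he : e ∈ F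
      · rw [split_tgt_inl_of_mem ⟨e, he⟩]
        change 2 * (π (G.src e) : ℕ) < 2 * (π (G.src e) : ℕ) + 1
        omega
      · rw [split_tgt_inl he]
        change 2 * (π (G.src e) : ℕ) < 2 * (π (G.tgt e) : ℕ)
        omega
    · have h1 : (π (G.src f.1) : ℕ) < π (G.tgt f.1) := hπ _ _ ⟨f.1, rfl, rfl⟩
      change 2 * (π (G.src f.1) : ℕ) + 1 < 2 * (π (G.tgt f.1) : ℕ)
      omega
  intro hv
  have : ∀ w, Relation.TransGen (G.split F).Adj v w → r v < r w := by
    intro w hw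
    induction hw with
    | single h => exact hr _ _ h
    | tail _ h ih => exact ih.trans (hr _ _ h)
  exact lt_irrefl _ (this v hv)

theorem split_isSource_inl {u : V} : (G.split F).IsSource (.inl u) ↔ G.IsSource u := by
  refine ⟨fun h e he => ?_, fun h e he => ?_⟩
  · by_cases hF : e ∈ F
    · exact h (.inr ⟨e, hF⟩) (congrArg Sum.inl he)
    · exact h (.inl e) ((split_tgt_inl hF).trans (congrArg Sum.inl he))
  · obtain e | f := e
    · by_cases hF : e ∈ F
      · rw [split_tgt_inl_of_mem ⟨e, hF⟩] at he
        exact absurd he (by simp)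
      · rw [split_tgt_inl hF] at he
        exact h e (Sum.inl.inj he)
    · exact h f.1 (Sum.inl.inj he)

theorem split_isSink_inl {u : V} : (G.split F).IsSink (.inl u) ↔ G.IsSink u := by
  refine ⟨fun h e he => h (.inl e) (congrArg Sum.inl he), fun h e he => ?_⟩
  obtain e | f := e
  · exact h e (Sum.inl.inj he)
  · exact Sum.inr_ne_inl (he : Sum.inr f = Sum.inl u)

theorem IsPlanarST.split [Fintype V] [Fintype E] {s t : V} (hG : G.IsPlanarST s t) :
    (G.split F).IsPlanarST (.inl s) (.inl t) where
  plane := by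
    refine ⟨split_connected hG.plane.1, ?_⟩
    have := hG.plane.2
    rw [card_split_face, Nat.card_sum, Nat.card_sum]
    omega
  acyclic := split_acyclic hG.acyclic
  no_parallel := by
    rintro (e | f) (e' | f') h1 h2
    · have h1' : G.src e = G.src e' := Sum.inl.inj h1
      by_cases he : e ∈ F <;> by_cases he' : e' ∈ F
      · rw [split_tgt_inl_of_mem ⟨e, he⟩, split_tgt_inl_of_mem ⟨e', he'⟩] at h2
        exact congrArg Sum.inl (congrArg Subtype.val (Sum.inr.inj h2))
      · rw [split_tgt_inl_of_mem ⟨e, he⟩, split_tgt_inl he'] at h2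
        exact absurd h2 (by simp)
      · rw [split_tgt_inl he, split_tgt_inl_of_mem ⟨e', he'⟩] at h2
        exact absurd h2 (by simp)
      · rw [split_tgt_inl he, split_tgt_inl he'] at h2
        rw [hG.no_parallel e e' h1' (Sum.inl.inj h2)]
    · exact absurd h1 Sum.inl_ne_inr
    · exact absurd h1 Sum.inr_ne_inl
    · exact congrArg Sum.inr (Sum.inr.inj h1)
  source_iff := by
    rintro (u | f)
    · rw [split_isSource_inl, hG.source_iff, Sum.inl.injEq]
    · exact iff_of_false (fun h => h (.inl f.1) (split_tgt_inl_of_mem f)) (by simp)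
  sink_iff := by
    rintro (u | f)
    · rw [split_isSink_inl, hG.sink_iff, Sum.inl.injEq]
    · exact iff_of_false (fun h => h (.inr f) rfl) (by simp)
  source_outer := by
    obtain ⟨d, rfl, hd⟩ := hG.source_outer
    exact ⟨_, G.vert_splitDart_inl F d, split_onOuter.2 hd⟩
  sink_outer := by
    obtain ⟨d, rfl, hd⟩ := hG.sink_outer
    exact ⟨_, G.vert_splitDart_inl F d, split_onOuter.2 hd⟩

/-- Each half of a split edge ends at a dummy vertex, whose corners lie between one incoming and one
outgoing dart, so it cannot join a source corner to a sink corner. Unsplit edges keep their corners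
and faces. -/
theorem split_not_isLeftBoundary (hF : ∀ e, G.IsLeftBoundary e → e ∈ F) (e : E ⊕ F) :
    ¬ (G.split F).IsLeftBoundary e := by
  rintro ⟨h1, h2, h3⟩
  obtain e | f := e
  · by_cases he : e ∈ F
    · rw [← splitDart_inr_true ⟨e, he⟩, split_rot_inv_inr] at h2
      exact Bool.false_ne_true h2.symm
    · rw [← splitDart_inl_true, split_rot_inl, splitDart_inl_snd] at h1
      rw [← splitDart_inl_false he, split_rot_inv_inl, splitDart_inl_snd] at h2
      rw [← splitDart_inl_false he, split_onOuter] at h3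
      exact he (hF e ⟨h1, h2, h3⟩)
  · rw [← splitDart_inr_false, split_rot_inr] at h1
    exact Bool.false_ne_true h1

theorem split_not_isRightBoundary (hF : ∀ e, G.IsRightBoundary e → e ∈ F) (e : E ⊕ F) :
    ¬ (G.split F).IsRightBoundary e := by
  rintro ⟨h1, h2, h3⟩
  obtain e | f := e
  · by_cases he : e ∈ F
    · rw [← splitDart_inr_true ⟨e, he⟩, split_rot_inr] at h2
      exact Bool.false_ne_true h2.symm
    · rw [← splitDart_inl_true, split_rot_inv_inl, splitDart_inl_snd] at h1
      rw [← splitDart_inl_false he, split_rot_inl, splitDart_inl_snd] at h2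
      rw [← splitDart_inl_true, split_onOuter] at h3
      exact he (hF e ⟨h1, h2, h3⟩)
  · rw [← splitDart_inr_false, split_rot_inv_inr] at h1
    exact Bool.false_ne_true h1

end Split

end EmbeddedDigraph

/-! ### The bound |V| - 3 -/

theorem mainTheorem7 {V E : Type*} [Fintype V] [Fintype E] [DecidableEq E]
    (G : EmbeddedDigraph V E) (s t : V) (hG : G.IsPlanarST s t) (hV : 3 ≤ Fintype.card V) :
    ∃ F : Finset E, F.card + 3 ≤ Fintype.card V ∧
      (G.split F).IsPlanarST (.inl s) (.inl t) ∧
      ∃ π, (G.split F).IsBitonicSTOrdering (.inl s) (.inl t) π := by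
  classical
  have h1 := hG.card_boundary_le hV
  have h2 := hG.three_mul_card_face_le hV
  have h3 := hG.plane.2
  rw [Nat.subtype_card (Finset.univ.filter G.IsLeftBoundary) (by simp),
    Nat.subtype_card (Finset.univ.filter G.IsRightBoundary) (by simp)] at h1
  rw [Nat.card_eq_fintype_card (α := V)] at h3
  -- Euler's formula and 3|F| ≤ 2|E| give |F| ≤ 2|V| - 4, so the two kinds of edges together number
  -- at most 2|V| - 5 and cannot both exceed |V| - 3.
  by_cases h : (Finset.univ.filter G.IsLeftBoundary).card + 3 ≤ Fintype.card V
  · exact ⟨_, h, hG.split, hG.split.exists_bitonic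
      (.inl (EmbeddedDigraph.split_not_isLeftBoundary fun e he => by simpa using he))⟩
  · exact ⟨Finset.univ.filter G.IsRightBoundary, by omega, hG.split, hG.split.exists_bitonic
      (.inr (EmbeddedDigraph.split_not_isRightBoundary fun e he => by simpa using he))⟩
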